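/- Let $n\ge 3$. Let $\mathcal F$ be the manifold of complete flags $W_1\subset\dots\subset W_{n-1}$ in $\mathbb R^n$ ($\dim W_j=j$), topologized as a subspace of the product of the Grassmannians $G(1,n)\times\dots\times G(n-1,n)$, and let $\pi_j:\mathcal F\to G(j,n)$, $\pi_j(W_1,\dots,W_{n-1})=W_j$, for $1\le j\le n-1$. A map $f:V\to\mathcal F$ defined on an open set $V\subset\mathcal F$ is fibration-preserving if for every $1\le j\le n-1$ and every $W_j\in G(j,n)$ there is $W_j'\in G(j,n)$ with $f(V\cap\pi_j^{-1}(W_j))\subset\pi_j^{-1}(W_j')$; it is locally fibration-preserving if every point of $V$ has an open neighborhood in $V$ on which $f$ is fibration-preserving. Let $N\subset GL(n,\mathbb R)$ be the group of upper triangular matrices with $1$s on the diagonal, with the dilations $\delta_r(y)=g_r\,y\,g_r^{-1}$, where $g_r=\operatorname{diag}(r^{-1},\dots,r^{-n})$, $r\neq 0$. A graded homomorphism $N\to N$ is a Lie group homomorphism that commutes with $\delta_r$ for all $r>0$. A map $h$ into $N$ defined on a neighborhood of $y_0\in N$ is Pansu differentiable at $y_0$, with Pansu differential $D$, if $D:N\to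 N$ is a graded homomorphism and the maps $y\mapsto \delta_r^{-1}\bigl(h(y_0)^{-1}h(y_0\,\delta_r(y))\bigr)$ converge to $D$ uniformly on compact subsets of $N$ as $r\to 0^+$. Let $W_j^-=\operatorname{span}(e_n,\dots,e_{n-j+1})$, and for $g\in PGL(n,\mathbb R)$ let $\alpha_g:N\to\mathcal F$, $\alpha_g(y)=g\,y\cdot(W_1^-,\dots,W_{n-1}^-)$, which is a homeomorphism onto an open subset of $\mathcal F$. A continuous map $f:U\to\mathcal F$ on an open set $U\subset\mathcal F$ is Pansu differentiable at $x\in U$, with Pansu differential $D$, if there are an open set $V$ with $x\in V\subset U$ and $g,g'\in PGL(n,\mathbb R)$ such that $V\subset\alpha_g(N)$, $f(V)\subset\alpha_{g'}(N)$, and $\alpha_{g'}^{-1}\circ f\circ\alpha_g$ is Pansu differentiable at $\alpha_g^{-1}(x)$ with Pansu differential $D$. (The property that $D$ is an isomorphism does not depend on the choice of $g,g'$.) Proposition. Let $U\subset\mathcal F$ be a connected open subset and let $f:U\to\mathcal F$ be a continuous, locally fibration-preserving map. Suppose that at some $x\in U$ the map $f$ has a Pansu differential that is an isomorphism. Then there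 is a $g\in PGL(n,\mathbb R)$ such that $f(W)=g\cdot W$ for every $W\in U$. -/

import Mathlib

open scoped Topology MatrixGroups
open Filter Set

namespace FlagRigidity

noncomputable section

/-! ### Grassmannians and the flag manifold -/

/-- The Grassmannian `G(j, n)` of `j`-dimensional linear subspaces of `ℝⁿ`. -/
def Grassmannian (j n : ℕ) : Type :=
  {W : Submodule ℝ (Fin n → ℝ) // Module.finrank ℝ W = j}

/-- The span of a linearly independent `j`-tuple of vectors. -/
def frameSpan (j n : ℕ) (v : {v : Fin j → Fin n → ℝ // LinearIndependent ℝ v}) :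
    Grassmannian j n :=
  ⟨Submodule.span ℝ (range v.1), by simpa using finrank_span_eq_card v.2⟩

/-- The usual topology of `G(j, n)`: the quotient topology from the (open) set of linearly
independent `j`-tuples in `(ℝⁿ)ʲ`. -/
instance instTopGrassmannian (j n : ℕ) : TopologicalSpace (Grassmannian j n) :=
  TopologicalSpace.coinduced (frameSpan j n) inferInstance

/-- Complete flags `W_1 ⊂ ⋯ ⊂ W_{n-1}` in `ℝⁿ`. The index `j : Fin (n - 1)` counts from `0`, so
that the component with index `j` is the subspace of dimension `j + 1`. -/
def FlagManifold (n : ℕ) : Type :=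
  {W : ∀ j : Fin (n - 1), Grassmannian (j + 1) n // ∀ i j, i ≤ j → (W i).1 ≤ (W j).1}

/-- The topology induced from the product of the Grassmannians. -/
instance instTopFlagManifold (n : ℕ) : TopologicalSpace (FlagManifold n) :=
  inferInstanceAs (TopologicalSpace
    {W : ∀ j : Fin (n - 1), Grassmannian (j + 1) n // ∀ i j, i ≤ j → (W i).1 ≤ (W j).1})

/-- The fibration `ℱ → G(j + 1, n)` onto the component of dimension `j + 1`, `0 ≤ j < n - 1`. -/
def proj {n : ℕ} (j : Fin (n - 1)) (W : FlagManifold n) : Grassmannian (j + 1) n :=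
  W.1 j

/-! ### The actions of `GL(n, ℝ)` and `PGL(n, ℝ)` -/

/-- The image `g(W)` of a subspace `W` of `ℝⁿ` under `g ∈ GL(n, ℝ)`. -/
def mapSubspace {n : ℕ} (g : GL (Fin n) ℝ) (W : Submodule ℝ (Fin n → ℝ)) :
    Submodule ℝ (Fin n → ℝ) :=
  W.map (Matrix.mulVecLin (g : Matrix (Fin n) (Fin n) ℝ))

theorem mapSubspace_one {n : ℕ} (W : Submodule ℝ (Fin n → ℝ)) : mapSubspace 1 W = W := by
  simp [mapSubspace]

theorem mapSubspace_mul {n : ℕ} (g h : GL (Fin n) ℝ) (W : Submodule ℝ (Fin n → ℝ)) :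
    mapSubspace (g * h) W = mapSubspace g (mapSubspace h W) := by
  simp [mapSubspace, Matrix.mulVecLin_mul, Submodule.map_comp]

theorem mapSubspace_scalar {n : ℕ} (u : ℝˣ) (W : Submodule ℝ (Fin n → ℝ)) :
    mapSubspace (Matrix.GeneralLinearGroup.scalar (Fin n) u) W = W := by
  have key : ∀ v : Fin n → ℝ, Matrix.mulVecLin
      (Matrix.GeneralLinearGroup.scalar (Fin n) u : Matrix (Fin n) (Fin n) ℝ) v = (u : ℝ) • v := by
    intro v
    ext i
    simp [Matrix.GeneralLinearGroup.coe_scalar, Matrix.mulVec_diagonal]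
  ext v
  simp only [mapSubspace, Submodule.mem_map, key]
  constructor
  · rintro ⟨w, hw, rfl⟩
    exact W.smul_mem _ hw
  · intro hv
    exact ⟨((u⁻¹ : ℝˣ) : ℝ) • v, W.smul_mem _ hv, by simp [smul_smul]⟩

theorem finrank_mapSubspace {n : ℕ} (g : GL (Fin n) ℝ) (W : Submodule ℝ (Fin n → ℝ)) :
    Module.finrank ℝ (mapSubspace g W) = Module.finrank ℝ W := by
  refine (LinearEquiv.finrank_eq (Submodule.equivMapOfInjective _ ?_ W)).symm
  exact Matrix.mulVec_injective_of_isUnit g.isUnit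

/-- The action `(g, W) ↦ g(W)` of `GL(n, ℝ)` on `G(j, n)`. -/
instance instActionGrassmannian (j n : ℕ) : MulAction (GL (Fin n) ℝ) (Grassmannian j n) where
  smul g W := ⟨mapSubspace g W.1, (finrank_mapSubspace g W.1).trans W.2⟩
  one_smul W := Subtype.ext (mapSubspace_one W.1)
  mul_smul g h W := Subtype.ext (mapSubspace_mul g h W.1)

/-- The action of `GL(n, ℝ)` on flags, component by component. -/
instance instActionFlag (n : ℕ) : MulAction (GL (Fin n) ℝ) (FlagManifold n) where
  smul g W := ⟨fun j => g • W.1 j, fun i j hij => Submodule.map_mono (W.2 i j hij)⟩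
  one_smul W := Subtype.ext (funext fun j => one_smul (GL (Fin n) ℝ) (W.1 j))
  mul_smul g h W := Subtype.ext (funext fun j => mul_smul g h (W.1 j))

/-- The induced action of `PGL(n, ℝ)` on flags. -/
instance instActionFlagPGL (n : ℕ) : MulAction PGL(Fin n, ℝ) (FlagManifold n) :=
  Matrix.ProjGenLinGroup.mulActionOfGL fun u W =>
    Subtype.ext (funext fun j => Subtype.ext (mapSubspace_scalar u (W.1 j).1))

/-! ### The Carnot group of unipotent upper triangular matrices -/

/-- The group `N` of upper triangular matrices with `1`s on the diagonal. -/
def unipotent (n : ℕ) : Subgroup (GL (Fin n) ℝ) where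
  carrier := {g | (∀ i j, j < i → g i j = 0) ∧ ∀ i, g i i = 1}
  one_mem' := ⟨fun i j h => by simp [h.ne'], fun i => by simp⟩
  mul_mem' := by
    rintro a b ⟨ha, ha'⟩ ⟨hb, hb'⟩
    have hab : ∀ i j k, k ≠ i ∨ k ≠ j → j ≤ i → a i k * b k j = 0 := by
      intro i j k hk hij
      rcases lt_or_ge k i with h | h
      · rw [ha i k h, zero_mul]
      · rw [hb k j (by grind), mul_zero]
    refine ⟨fun i j h => ?_, fun i => ?_⟩
    · rw [Matrix.GeneralLinearGroup.coe_mul, Matrix.mul_apply]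
      exact Finset.sum_eq_zero fun k _ => hab i j k (by grind) h.le
    · rw [Matrix.GeneralLinearGroup.coe_mul, Matrix.mul_apply,
        Finset.sum_eq_single i (fun k _ hk => hab i i k (Or.inl hk) le_rfl) (by simp), ha', hb',
        mul_one]
  inv_mem' := by
    rintro a ⟨ha, ha'⟩
    have htri : Matrix.BlockTriangular (a : Matrix (Fin n) (Fin n) ℝ) id := fun i j h => ha i j h
    have hinv : ∀ i j, j < i → (a⁻¹ : GL (Fin n) ℝ) i j = 0 := by
      intro i j h
      rw [Matrix.GeneralLinearGroup.coe_inv]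
      have : Invertible (a : Matrix (Fin n) (Fin n) ℝ) := a.invertible
      exact Matrix.blockTriangular_inv_of_blockTriangular htri h
    refine ⟨hinv, fun i => ?_⟩
    have h1 : ((a * a⁻¹ : GL (Fin n) ℝ) : Matrix (Fin n) (Fin n) ℝ) i i = 1 := by simp
    rw [Matrix.GeneralLinearGroup.coe_mul, Matrix.mul_apply, Finset.sum_eq_single i ?_ (by simp),
      ha', one_mul] at h1
    · exact h1
    · intro k _ hk
      rcases lt_or_gt_of_ne hk with h | h
      · rw [ha i k h, zero_mul]
      · rw [hinv k i h, mul_zero]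

/-- The diagonal matrix `diag(r⁻¹, r⁻², …, r⁻ⁿ)`. -/
def diagPow (n : ℕ) (r : ℝˣ) : GL (Fin n) ℝ where
  val := Matrix.diagonal fun i => ((r ^ ((i : ℕ) + 1))⁻¹ : ℝˣ)
  inv := Matrix.diagonal fun i => (r ^ ((i : ℕ) + 1) : ℝˣ)
  val_inv := by
    rw [Matrix.diagonal_mul_diagonal, ← Matrix.diagonal_one]
    congr 1; funext i; exact Units.inv_mul _
  inv_val := by
    rw [Matrix.diagonal_mul_diagonal, ← Matrix.diagonal_one]
    congr 1; funext i; exact Units.mul_inv _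

theorem diagPow_conj_apply (n : ℕ) (r : ℝˣ) (g : GL (Fin n) ℝ) (i j : Fin n) :
    (diagPow n r * g * (diagPow n r)⁻¹) i j =
      ((r ^ ((i : ℕ) + 1))⁻¹ : ℝˣ) * g i j * (r ^ ((j : ℕ) + 1) : ℝˣ) := by
  change (((Matrix.diagonal fun i : Fin n => (((r ^ ((i : ℕ) + 1))⁻¹ : ℝˣ) : ℝ)) *
    (g : Matrix (Fin n) (Fin n) ℝ)) *
    Matrix.diagonal fun i : Fin n => ((r ^ ((i : ℕ) + 1) : ℝˣ) : ℝ) :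
      Matrix (Fin n) (Fin n) ℝ) i j = _
  rw [Matrix.mul_diagonal, Matrix.diagonal_mul]

theorem diagPow_conj_mem (n : ℕ) (r : ℝˣ) {g : GL (Fin n) ℝ} (hg : g ∈ unipotent n) :
    diagPow n r * g * (diagPow n r)⁻¹ ∈ unipotent n := by
  refine ⟨fun i j h => ?_, fun i => ?_⟩
  · rw [diagPow_conj_apply, hg.1 i j h, mul_zero, zero_mul]
  · rw [diagPow_conj_apply, hg.2 i, mul_one, Units.inv_mul]

/-- The Carnot dilation `δ_r : N → N`, conjugation with `diag(r⁻¹, …, r⁻ⁿ)`. -/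
def dilation {n : ℕ} (r : ℝˣ) (g : unipotent n) : unipotent n :=
  ⟨diagPow n r * g * (diagPow n r)⁻¹, diagPow_conj_mem n r g.2⟩

/-- Graded homomorphisms `N → N`: Lie group homomorphisms (that is, continuous homomorphisms)
which commute with the dilations `δ_r`, `r > 0`. -/
def IsGraded {n : ℕ} (D : unipotent n →* unipotent n) : Prop :=
  Continuous D ∧ ∀ r : ℝˣ, 0 < (r : ℝ) → ∀ y, dilation r (D y) = D (dilation r y)

/-- The rescaling `y ↦ δ_r⁻¹ (h(x)⁻¹ h(x δ_r(y)))` of `h` at `x`. -/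
def rescale {n : ℕ} (h : unipotent n → unipotent n) (x : unipotent n) (r : ℝˣ) (y : unipotent n) :
    unipotent n :=
  dilation r⁻¹ ((h x)⁻¹ * h (x * dilation r y))

/-- `D` is the Pansu differential at `x` of the map `h`, which need only be meaningful near `x`:
`D` is a graded homomorphism, and as `r → 0`, `r > 0`, the rescalings of `h` at `x`
converge to `D` uniformly on compact subsets of `N`. -/
def HasPansuDifferentialAt {n : ℕ} (h : unipotent n → unipotent n)
    (D : unipotent n →* unipotent n) (x : unipotent n) : Prop :=
  IsGraded D ∧ ∀ K : Set (unipotent n), IsCompact K →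
    TendstoUniformlyOn
      (fun (r : ℝˣ) y => ((rescale h x r y : GL (Fin n) ℝ) : Matrix (Fin n) (Fin n) ℝ))
      (fun y => ((D y : GL (Fin n) ℝ) : Matrix (Fin n) (Fin n) ℝ))
      (comap ((↑) : ℝˣ → ℝ) (𝓝[>] 0)) K

/-! ### Charts of the flag manifold and the Pansu differential there -/

/-- The span `W_j^-` of the last `j` standard basis vectors of `ℝⁿ`. -/
def lowerSpace (n j : ℕ) : Submodule ℝ (Fin n → ℝ) :=
  Submodule.span ℝ ((fun i : Fin n => (Pi.single i 1 : Fin n → ℝ)) '' {i | n ≤ (i : ℕ) + j})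

theorem finrank_lowerSpace {n j : ℕ} (hj : j ≤ n) : Module.finrank ℝ (lowerSpace n j) = j := by
  have hli : LinearIndependent ℝ (fun i : Fin n => (Pi.single i 1 : Fin n → ℝ)) :=
    Pi.linearIndependent_single_one (Fin n) ℝ
  have h := finrank_span_eq_card (hli.comp (fun k : Fin j => (⟨n - j + k, by omega⟩ : Fin n))
    (fun a b hab => by simpa [Fin.ext_iff] using hab))
  rw [Fintype.card_fin] at h
  have hrange : (fun i : Fin n => (Pi.single i 1 : Fin n → ℝ)) '' {i | n ≤ (i : ℕ) + j} =
      range ((fun i : Fin n => (Pi.single i 1 : Fin n → ℝ)) ∘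
        (fun k : Fin j => (⟨n - j + k, by omega⟩ : Fin n))) := by
    rw [range_comp]
    congr 1
    ext i
    constructor
    · intro (hi : n ≤ (i : ℕ) + j)
      exact ⟨⟨(i : ℕ) - (n - j), by omega⟩, Fin.ext (by change n - j + (i - (n - j)) = i; omega)⟩
    · rintro ⟨k, rfl⟩
      change n ≤ n - j + (k : ℕ) + j
      omega
  rw [lowerSpace, hrange]
  exact h

/-- The base flag `(W_1^-, …, W_{n-1}^-)`. -/
def baseFlag (n : ℕ) : FlagManifold n :=
  ⟨fun j => ⟨lowerSpace n (j + 1), finrank_lowerSpace (by omega)⟩, fun i j hij =>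
    Submodule.span_mono (image_mono fun k (hk : n ≤ (k : ℕ) + (i + 1)) =>
      (by have : (i : ℕ) ≤ j := hij
          change n ≤ (k : ℕ) + (j + 1)
          omega))⟩

/-- The orbit map `α : N → ℱ`, `α(y) = y · (W_1^-, …, W_{n-1}^-)`. -/
def orbitMap {n : ℕ} (y : unipotent n) : FlagManifold n :=
  (y : GL (Fin n) ℝ) • baseFlag n

/-- The translate `y ↦ g · α(y)` of the orbit map, a parametrization of the open set `g · α(N)`. -/
def chart {n : ℕ} (g : PGL(Fin n, ℝ)) (y : unipotent n) : FlagManifold n :=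
  g • orbitMap y

/-- `D` is a Pansu differential at `x ∈ U` of `f : U → ℱ`: for some open `V` with `x ∈ V ⊆ U` and
some `g, g'` such that `V` and `f(V)` lie in the images of the charts of `g` and `g'`, it is the
Pansu differential of `f` read in these charts. -/
def HasFlagPansuDifferentialAt {n : ℕ} (U : Set (FlagManifold n))
    (f : FlagManifold n → FlagManifold n) (D : unipotent n →* unipotent n)
    (x : FlagManifold n) : Prop :=
  ∃ V : Set (FlagManifold n), IsOpen V ∧ x ∈ V ∧ V ⊆ U ∧ ∃ g g' : PGL(Fin n, ℝ),
    V ⊆ range (chart g) ∧ f '' V ⊆ range (chart g') ∧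
    HasPansuDifferentialAt (Function.invFun (chart g') ∘ f ∘ chart g) D
      (Function.invFun (chart g) x)

/-! ### Fibration-preserving maps -/

/-- `f` maps the part in `V` of each fiber of each `π_j` into some fiber of the same `π_j`. -/
def FibrationPreservingOn {n : ℕ} (f : FlagManifold n → FlagManifold n)
    (V : Set (FlagManifold n)) : Prop :=
  ∀ (j : Fin (n - 1)) (W : Grassmannian (j + 1) n), ∃ W' : Grassmannian (j + 1) n,
    f '' (V ∩ proj j ⁻¹' {W}) ⊆ proj j ⁻¹' {W'}

/-- `f` is fibration preserving near each point of the open set `U`. -/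
def LocallyFibrationPreservingOn {n : ℕ} (f : FlagManifold n → FlagManifold n)
    (U : Set (FlagManifold n)) : Prop :=
  ∀ x ∈ U, ∃ V : Set (FlagManifold n), IsOpen V ∧ x ∈ V ∧ V ⊆ U ∧ FibrationPreservingOn f V

end

end FlagRigidity

/-! Near each flag a fibration-preserving map acts on lines, planes, ..., hyperplanes and respects
incidence (`exists_incidenceMap`). The theorem is thus a local form of the fundamental theorem of
projective geometry, in which only flags of frames from an open set may be used.

Local rigidity. Suppose that `n + 1` lines in general position go to `n + 1` lines in general
position. Choose coordinates on both sides in which `n` of the lines are the axes and the last is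
the unit point. A hyperplane containing all axes but the `i`-th and `j`-th is given by a ratio `x i
: x j`, and it goes to a hyperplane of the same kind, so the ratio of the image coordinates depends
only on `x i : x j` (`IncidenceMap.ratio_eq`). In logarithmic coordinates this is Cauchy's equation,
and as `n ≥ 3` all pairs share one slope `a`: the map is `x k ↦ x k ^ a` up to a common factor
(`exists_rpow_of_ratio`). Lines in a plane go to lines in a plane, which forces `a = 0` or `a = 1`
(`IncidenceMap.exponent_eq_zero_or_one`): near the unit point the map on lines is constant or
projective.

Finding the frame. The Pansu differential `D` inherits from the fibrations that it preserves the
stabilizers of the members of the base flag. So it sends an elementary matrix at `(i, i + 1)` to a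
matrix with a single off-diagonal entry, nonzero as `D` is injective. Products of these give `w`
whose last column is all ones while that of `D w` has no zero entry (`BlowUp.exists_last_column`).
The lines of `δ_s w` then trace the moment curve, and the rescaled image lines converge to a moment
curve with coordinates multiplied by nonzero constants. For small `r`, any `n` of the lines at `n +
1` fixed multiples of `r` therefore have independent images. The constant alternative cannot hold at
all small `r`, since one coordinate of the image curve has exact order `s`
(`BlowUp.not_locally_const`). Hence the map is projective near some flag
(`BlowUp.exists_projective`).

Unique continuation. If lines near one point are fixed, so are the planes through them and hence
further lines, as intersections of such planes. This propagation has a locally uniform radius, so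
local agreement with a projective map spreads over the connected set `U`
(`eqOn_smul_of_eventually`). -/

namespace FlagRigidity

/-! ### Orthogonal projections onto spans -/

section Projection

open Matrix

variable {j n : ℕ}

/-- The matrix of the orthogonal projection onto the span of a linearly independent tuple. -/
noncomputable def gramProjection (v : Fin j → Fin n → ℝ) : Matrix (Fin n) (Fin n) ℝ :=
  (Matrix.of v)ᵀ * (Matrix.of v * (Matrix.of v)ᵀ)⁻¹ * Matrix.of v

theorem isUnit_det_gram {v : Fin j → Fin n → ℝ} (hv : LinearIndependent ℝ v) :
    IsUnit (Matrix.of v * (Matrix.of v)ᵀ).det := by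
  rw [← Matrix.isUnit_iff_isUnit_det, ← Matrix.mulVec_injective_iff_isUnit]
  rw [← Matrix.coe_mulVecLin, ← LinearMap.ker_eq_bot, LinearMap.ker_eq_bot']
  intro c hc
  have h1 : (Matrix.of v)ᵀ *ᵥ c = 0 := by
    have hc' : Matrix.of v *ᵥ ((Matrix.of v)ᵀ *ᵥ c) = 0 := by
      rw [Matrix.mulVec_mulVec]
      exact hc
    rw [← dotProduct_self_eq_zero, Matrix.dotProduct_mulVec, Matrix.vecMul_transpose, hc',
      zero_dotProduct]
  have h2 : Function.Injective (Matrix.of v)ᵀ.mulVec := by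
    rw [Matrix.mulVec_injective_iff]
    exact hv
  exact h2 (by rw [h1, Matrix.mulVec_zero])

theorem gramProjection_transpose (v : Fin j → Fin n → ℝ) :
    (gramProjection v)ᵀ = gramProjection v := by
  simp [gramProjection, Matrix.transpose_mul, Matrix.transpose_nonsing_inv, Matrix.mul_assoc]

theorem transpose_mulVec_mem_span (v : Fin j → Fin n → ℝ) (c : Fin j → ℝ) :
    (Matrix.of v)ᵀ *ᵥ c ∈ Submodule.span ℝ (range v) := by
  rw [Matrix.mulVec_eq_sum]
  refine Submodule.sum_mem _ fun k _ => ?_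
  rw [op_smul_eq_smul]
  exact Submodule.smul_mem _ _ (Submodule.subset_span (mem_range_self k))

theorem gramProjection_mulVec_mem (v : Fin j → Fin n → ℝ) (x : Fin n → ℝ) :
    gramProjection v *ᵥ x ∈ Submodule.span ℝ (range v) := by
  rw [gramProjection, Matrix.mul_assoc, ← Matrix.mulVec_mulVec]
  exact transpose_mulVec_mem_span v _

theorem gramProjection_mulVec_of_mem {v : Fin j → Fin n → ℝ} (hv : LinearIndependent ℝ v)
    {x : Fin n → ℝ} (hx : x ∈ Submodule.span ℝ (range v)) : gramProjection v *ᵥ x = x := by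
  have h : gramProjection v * (Matrix.of v)ᵀ = (Matrix.of v)ᵀ := by
    rw [gramProjection, Matrix.mul_assoc, Matrix.mul_assoc,
      Matrix.nonsing_inv_mul _ (isUnit_det_gram hv), Matrix.mul_one]
  induction hx using Submodule.span_induction with
  | mem x hx =>
    obtain ⟨k, rfl⟩ := hx
    have := congrArg (fun M : Matrix (Fin n) (Fin j) ℝ => M.col k) h
    ext i
    exact congrFun this i
  | zero => simp
  | add x y _ _ hx hy => rw [Matrix.mulVec_add, hx, hy]
  | smul a x _ hx => rw [Matrix.mulVec_smul, hx]

/-- Each projection is the identity on the range of the other. Transposing one of the two resulting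
product identities and using symmetry identifies both with the same product. -/
theorem gramProjection_eq_of_span_eq {v w : Fin j → Fin n → ℝ} (hv : LinearIndependent ℝ v)
    (hw : LinearIndependent ℝ w)
    (h : Submodule.span ℝ (range v) = Submodule.span ℝ (range w)) :
    gramProjection v = gramProjection w := by
  have key : ∀ {v w : Fin j → Fin n → ℝ}, LinearIndependent ℝ w →
      Submodule.span ℝ (range v) = Submodule.span ℝ (range w) →
      gramProjection w * gramProjection v = gramProjection v := by
    intro v w hw h
    refine Matrix.ext_of_mulVec_single fun i => ?_
    rw [← Matrix.mulVec_mulVec]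
    exact gramProjection_mulVec_of_mem hw (h ▸ gramProjection_mulVec_mem v _)
  have h1 := key hw h
  have h2 := congrArg Matrix.transpose (key hv h.symm)
  rw [Matrix.transpose_mul, gramProjection_transpose, gramProjection_transpose] at h2
  rw [← h1, h2]

theorem continuous_gramProjection :
    Continuous fun v : {v : Fin j → Fin n → ℝ // LinearIndependent ℝ v} =>
      gramProjection v.1 := by
  have hB : Continuous fun v : {v : Fin j → Fin n → ℝ // LinearIndependent ℝ v} =>
      Matrix.of v.1 := continuous_subtype_val
  have hG := hB.matrix_mul hB.matrix_transpose
  have hdet := hG.matrix_det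
  have hinv : Continuous fun v : {v : Fin j → Fin n → ℝ // LinearIndependent ℝ v} =>
      (Matrix.of v.1 * (Matrix.of v.1)ᵀ)⁻¹ := by
    simp only [Matrix.inv_def, Ring.inverse_eq_inv']
    exact (hdet.inv₀ fun v => (isUnit_det_gram v.2).ne_zero).smul hG.matrix_adjugate
  exact (hB.matrix_transpose.matrix_mul hinv).matrix_mul hB

theorem frameSpan_surjective : Function.Surjective (frameSpan j n) := by
  rintro ⟨W, hW⟩
  let b := Module.finBasisOfFinrankEq ℝ W hW
  refine ⟨⟨fun k => (b k : Fin n → ℝ), ?_⟩, Subtype.ext ?_⟩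
  · exact b.linearIndependent.map' W.subtype W.ker_subtype
  · change Submodule.span ℝ (range (W.subtype ∘ b)) = W
    rw [range_comp, Submodule.span_image, b.span_eq, Submodule.map_top, Submodule.range_subtype]

/-- The matrix of the orthogonal projection onto a subspace. -/
noncomputable def projectionMatrix (W : Grassmannian j n) : Matrix (Fin n) (Fin n) ℝ :=
  gramProjection (Function.surjInv frameSpan_surjective W).1

theorem span_surjInv (W : Grassmannian j n) :
    Submodule.span ℝ (range (Function.surjInv frameSpan_surjective W).1) = W.1 :=
  congrArg Subtype.val (Function.surjInv_eq frameSpan_surjective W)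

theorem projectionMatrix_mulVec_mem (W : Grassmannian j n) (x : Fin n → ℝ) :
    projectionMatrix W *ᵥ x ∈ W.1 := by
  have := gramProjection_mulVec_mem (Function.surjInv frameSpan_surjective W).1 x
  rwa [span_surjInv] at this

theorem projectionMatrix_mulVec_of_mem (W : Grassmannian j n) {x : Fin n → ℝ} (hx : x ∈ W.1) :
    projectionMatrix W *ᵥ x = x :=
  gramProjection_mulVec_of_mem (Function.surjInv frameSpan_surjective W).2
    (by rwa [span_surjInv])

/-- The topology is coinduced from frames, where the Gram formula is continuous. This is the source
of all continuous choices of vectors in varying subspaces. -/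
theorem continuous_projectionMatrix :
    Continuous (projectionMatrix : Grassmannian j n → Matrix (Fin n) (Fin n) ℝ) := by
  rw [continuous_coinduced_dom]
  refine continuous_gramProjection.congr fun v => ?_
  exact (gramProjection_eq_of_span_eq (Function.surjInv frameSpan_surjective _).2 v.2
    (span_surjInv _)).symm

end Projection

/-! ### Frames and their flags -/

section Frames

variable {n : ℕ}

/-- The span of the first `d` vectors of a tuple. -/
def spanLT (v : Fin n → Fin n → ℝ) (d : ℕ) : Submodule ℝ (Fin n → ℝ) :=
  Submodule.span ℝ (v '' {m | (m : ℕ) < d})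

theorem mem_spanLT (v : Fin n → Fin n → ℝ) {m : Fin n} {d : ℕ} (h : (m : ℕ) < d) :
    v m ∈ spanLT v d :=
  Submodule.subset_span ⟨m, h, rfl⟩

theorem spanLT_mono (v : Fin n → Fin n → ℝ) {d e : ℕ} (h : d ≤ e) : spanLT v d ≤ spanLT v e :=
  Submodule.span_mono (image_mono fun _ hm => lt_of_lt_of_le hm h)

theorem spanLT_le_iff (v : Fin n → Fin n → ℝ) (d : ℕ) (W : Submodule ℝ (Fin n → ℝ)) :
    spanLT v d ≤ W ↔ ∀ m : Fin n, (m : ℕ) < d → v m ∈ W := by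
  rw [spanLT, Submodule.span_le]
  exact ⟨fun h m hm => h ⟨m, hm, rfl⟩, by rintro h _ ⟨m, hm, rfl⟩; exact h m hm⟩

theorem spanLT_eq_span_range (v : Fin n → Fin n → ℝ) {d : ℕ} (hd : d ≤ n) :
    spanLT v d = Submodule.span ℝ (range fun i : Fin d => v (Fin.castLE hd i)) := by
  rw [spanLT]
  congr 1
  ext x
  constructor
  · rintro ⟨m, hm, rfl⟩
    exact ⟨⟨m, hm⟩, rfl⟩
  · rintro ⟨i, rfl⟩
    exact ⟨Fin.castLE hd i, i.2, rfl⟩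

theorem linearIndependent_castLE {v : Fin n → Fin n → ℝ} (hv : LinearIndependent ℝ v) {d : ℕ}
    (hd : d ≤ n) : LinearIndependent ℝ fun i : Fin d => v (Fin.castLE hd i) :=
  hv.comp _ (Fin.castLE_injective hd)

theorem finrank_spanLT {v : Fin n → Fin n → ℝ} (hv : LinearIndependent ℝ v) {d : ℕ}
    (hd : d ≤ n) : Module.finrank ℝ (spanLT v d) = d := by
  rw [spanLT_eq_span_range v hd, finrank_span_eq_card (linearIndependent_castLE hv hd),
    Fintype.card_fin]

/-- The flag of the spans of the initial segments of a basis of `ℝⁿ`. -/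
def frameFlag (v : {v : Fin n → Fin n → ℝ // LinearIndependent ℝ v}) : FlagManifold n :=
  ⟨fun j => ⟨spanLT v.1 (j + 1), finrank_spanLT v.2 (by omega)⟩,
    fun i j hij => spanLT_mono v.1 (Nat.succ_le_succ hij)⟩

theorem continuous_frameFlag : Continuous (frameFlag (n := n)) := by
  refine Continuous.subtype_mk (f := fun v : {v : Fin n → Fin n → ℝ // LinearIndependent ℝ v} =>
    (frameFlag v).1) (continuous_pi fun j => ?_) _
  have h : Continuous fun v : {v : Fin n → Fin n → ℝ // LinearIndependent ℝ v} =>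
      frameSpan (j + 1) n ⟨fun i => v.1 (Fin.castLE (by omega) i),
        linearIndependent_castLE v.2 (by omega)⟩ := by
    refine (continuous_coinduced_rng (f := frameSpan (j + 1) n)).comp (Continuous.subtype_mk ?_ _)
    exact continuous_pi fun i => (continuous_apply (Fin.castLE (by omega) i)).comp
      continuous_subtype_val
  refine h.congr fun v => Subtype.ext ?_
  exact (spanLT_eq_span_range v.1 (by omega)).symm

theorem flag_eq_frameFlag {W : FlagManifold n}
    {v : {v : Fin n → Fin n → ℝ // LinearIndependent ℝ v}}
    (h : ∀ (j : Fin (n - 1)) (m : Fin n), (m : ℕ) ≤ j → v.1 m ∈ (W.1 j).1) :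
    frameFlag v = W := by
  refine Subtype.ext (funext fun j => Subtype.ext ?_)
  refine Submodule.eq_of_le_of_finrank_eq ?_ ?_
  · exact (spanLT_le_iff _ _ _).2 fun m hm => h j m (Nat.lt_succ_iff.1 hm)
  · rw [(W.1 j).2]
    exact finrank_spanLT v.2 (by omega)

theorem frameFlag_surjective : Function.Surjective (frameFlag (n := n)) := by
  intro W
  -- The flag completed by `⊥` and `⊤` and indexed by dimension. As `0 - 1 = 0` in `ℕ`, dimension
  -- `0` needs a separate test. A frame is obtained by picking `v m` in `X (m + 1)` outside `X m`.
  let X : ℕ → Submodule ℝ (Fin n → ℝ) := fun d =>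
    if h : d - 1 < n - 1 then (if d = 0 then ⊥ else (W.1 ⟨d - 1, h⟩).1)
    else (if d = 0 then ⊥ else ⊤)
  have hX0 : X 0 = ⊥ := by simp [X]
  have hXj : ∀ j : Fin (n - 1), X (j + 1) = (W.1 j).1 := by
    intro j
    simp [X]
  have hXtop : ∀ d, n ≤ d → d ≠ 0 → X d = ⊤ := by
    intro d hd h0
    have : ¬ (d - 1 < n - 1) := by omega
    simp [X, this, h0]
  have hrank : ∀ d, d ≤ n → Module.finrank ℝ (X d) = d := by
    intro d hd
    rcases Nat.eq_zero_or_pos d with rfl | h0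
    · simp [hX0]
    · rcases hd.lt_or_eq with h | rfl
      · have := hXj ⟨d - 1, by omega⟩
        simp only [Nat.sub_add_cancel h0] at this
        rw [this, (W.1 _).2]
        simp only
        omega
      · rw [hXtop d le_rfl h0.ne', finrank_top, Module.finrank_fin_fun]
  have hmono1 : ∀ d, d < n → X d ≤ X (d + 1) := by
    intro d hd
    rcases Nat.eq_zero_or_pos d with rfl | h0
    · simp [hX0]
    · rcases (Nat.succ_le_of_lt hd).lt_or_eq with h | h
      · have h1 := hXj ⟨d - 1, by omega⟩
        have h2 := hXj ⟨d, by omega⟩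
        simp only [Nat.sub_add_cancel h0] at h1
        rw [h1, h2]
        exact W.2 _ _ (by rw [Fin.mk_le_mk]; omega)
      · rw [hXtop (d + 1) h.ge (by omega)]
        exact le_top
  have hex : ∀ m : Fin n, ∃ x, x ∈ X (m + 1) ∧ x ∉ X m := by
    intro m
    by_contra! hcon
    have hle : X (m + 1) ≤ X m := hcon
    have := Submodule.finrank_mono hle
    rw [hrank _ (by omega), hrank _ (by omega)] at this
    omega
  choose v hv hv' using hex
  have hspan : ∀ d, d ≤ n → spanLT v d = X d := by
    intro d
    induction d with
    | zero =>
      intro _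
      simp [spanLT, hX0]
    | succ d ih =>
      intro hd
      have ih := ih (by omega)
      refine Submodule.eq_of_le_of_finrank_le ?_ ?_
      · rw [spanLT_le_iff]
        intro m hm
        rcases (Nat.lt_succ_iff.1 hm).lt_or_eq with h | h
        · exact hmono1 d (by omega) (ih ▸ mem_spanLT v h)
        · rw [← h]
          exact hv m
      · rw [hrank _ hd]
        have hlt : spanLT v d < spanLT v (d + 1) := by
          refine lt_of_le_of_ne (spanLT_mono v (by omega)) fun heq => ?_
          have h1 := mem_spanLT v (m := ⟨d, by omega⟩) (d := d + 1) (by simp)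
          rw [← heq, ih] at h1
          exact hv' ⟨d, by omega⟩ h1
        have := Submodule.finrank_lt_finrank_of_lt hlt
        rw [ih, hrank _ (by omega)] at this
        omega
  rcases Nat.eq_zero_or_pos n with hn | hn
  · subst hn
    exact ⟨⟨v, linearIndependent_empty_type⟩, Subtype.ext (funext fun j => j.elim0)⟩
  have hli : LinearIndependent ℝ v := by
    refine linearIndependent_of_top_le_span_of_card_eq_finrank ?_ (by simp)
    rw [← hXtop n le_rfl hn.ne', ← hspan n le_rfl]
    exact Submodule.span_mono (image_subset_range _ _)
  refine ⟨⟨v, hli⟩, flag_eq_frameFlag fun j m hm => ?_⟩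
  rw [← hXj j, ← hspan _ (by omega)]
  exact mem_spanLT v (Nat.lt_succ_of_le hm)

theorem isOpen_linearIndependent :
    IsOpen {v : Fin n → Fin n → ℝ | LinearIndependent ℝ v} :=
  isOpen_setOfPred_linearIndependent

/-- A continuous choice, near a given flag, of bases adapted to flags. -/
noncomputable def adaptedFrame (v : Fin n → Fin n → ℝ) (W : FlagManifold n) : Fin n → Fin n → ℝ :=
  fun m => if h : (m : ℕ) < n - 1 then (projectionMatrix (W.1 ⟨m, h⟩)).mulVec (v m) else v m

theorem continuous_proj (j : Fin (n - 1)) : Continuous (proj (n := n) j) :=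
  (continuous_apply j).comp continuous_subtype_val

theorem continuous_adaptedFrame (v : Fin n → Fin n → ℝ) : Continuous (adaptedFrame v) := by
  refine continuous_pi fun m => ?_
  by_cases h : (m : ℕ) < n - 1
  · simp only [adaptedFrame, h, dif_pos]
    exact (continuous_projectionMatrix.comp (continuous_proj ⟨m, h⟩)).matrix_mulVec
      continuous_const
  · simp only [adaptedFrame, h, dif_neg, not_false_eq_true]
    exact continuous_const

theorem adaptedFrame_frameFlag (v : {v : Fin n → Fin n → ℝ // LinearIndependent ℝ v}) :
    adaptedFrame v.1 (frameFlag v) = v.1 := by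
  funext m
  by_cases h : (m : ℕ) < n - 1
  · simp only [adaptedFrame, h, dif_pos]
    exact projectionMatrix_mulVec_of_mem _ (mem_spanLT v.1 (Nat.lt_succ_self _))
  · simp [adaptedFrame, h]

theorem frameFlag_adaptedFrame (v : Fin n → Fin n → ℝ) (W : FlagManifold n)
    (h : LinearIndependent ℝ (adaptedFrame v W)) : frameFlag ⟨adaptedFrame v W, h⟩ = W := by
  refine flag_eq_frameFlag fun j m hm => ?_
  have hm' : (m : ℕ) < n - 1 := by omega
  simp only [adaptedFrame, hm', dif_pos]
  exact W.2 ⟨m, hm'⟩ j hm (projectionMatrix_mulVec_mem _ _)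

/-- `adaptedFrame v` is continuous, takes the flag of `v` back to `v`, and is a section of
`frameFlag` wherever its value is a basis. So flags close to that of `v` come from frames close to
`v`. -/
theorem isOpenMap_frameFlag : IsOpenMap (frameFlag (n := n)) := by
  rw [isOpenMap_iff_nhds_le]
  intro v s hs
  have hs' : Subtype.val '' (frameFlag ⁻¹' s) ∈ 𝓝 v.1 :=
    (isOpen_linearIndependent.isOpenMap_subtype_val).image_mem_nhds hs
  have := (continuous_adaptedFrame v.1).continuousAt (x := frameFlag v)
  rw [ContinuousAt, adaptedFrame_frameFlag] at this
  filter_upwards [this hs'] with W hW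
  obtain ⟨w, hw, hwW⟩ := hW
  have hli : LinearIndependent ℝ (adaptedFrame v.1 W) := hwW ▸ w.2
  have hw' : w = ⟨adaptedFrame v.1 W, hli⟩ := Subtype.ext hwW
  have : frameFlag w = W := by rw [hw', frameFlag_adaptedFrame]
  rw [← this]
  exact hw

theorem isQuotientMap_frameFlag : Topology.IsQuotientMap (frameFlag (n := n)) :=
  isOpenMap_frameFlag.isQuotientMap continuous_frameFlag frameFlag_surjective

/-- The bases of `ℝⁿ` whose flags lie in `V`. -/
def frameSet (V : Set (FlagManifold n)) : Set (Fin n → Fin n → ℝ) :=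
  {v | ∃ hv : LinearIndependent ℝ v, frameFlag ⟨v, hv⟩ ∈ V}

theorem isOpen_frameSet {V : Set (FlagManifold n)} (hV : IsOpen V) : IsOpen (frameSet V) := by
  have h : frameSet V = Subtype.val '' (frameFlag ⁻¹' V) := by
    ext v
    constructor
    · rintro ⟨hv, h⟩
      exact ⟨⟨v, hv⟩, h, rfl⟩
    · rintro ⟨w, hw, rfl⟩
      exact ⟨w.2, hw⟩
  rw [h]
  exact (isOpen_linearIndependent.isOpenMap_subtype_val) _ (hV.preimage continuous_frameFlag)

/-! ### The action on flags of frames -/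

theorem linearIndependent_mulVec (g : GL (Fin n) ℝ) {v : Fin n → Fin n → ℝ}
    (hv : LinearIndependent ℝ v) :
    LinearIndependent ℝ fun m => (g : Matrix (Fin n) (Fin n) ℝ).mulVec (v m) :=
  hv.map' (Matrix.mulVecLin (g : Matrix (Fin n) (Fin n) ℝ))
    (LinearMap.ker_eq_bot.2 (Matrix.mulVec_injective_of_isUnit g.isUnit))

theorem mapSubspace_spanLT (g : GL (Fin n) ℝ) (v : Fin n → Fin n → ℝ) (d : ℕ) :
    mapSubspace g (spanLT v d) =
      spanLT (fun m => (g : Matrix (Fin n) (Fin n) ℝ).mulVec (v m)) d := by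
  rw [mapSubspace, spanLT, Submodule.map_span, image_image]
  rfl

theorem smul_frameFlag (g : GL (Fin n) ℝ) (v : {v : Fin n → Fin n → ℝ // LinearIndependent ℝ v}) :
    g • frameFlag v = frameFlag ⟨_, linearIndependent_mulVec g v.2⟩ :=
  Subtype.ext (funext fun _ => Subtype.ext (mapSubspace_spanLT g v.1 _))

theorem continuous_smul_flag (g : GL (Fin n) ℝ) :
    Continuous fun W : FlagManifold n => g • W := by
  rw [isQuotientMap_frameFlag.continuous_iff]
  have h : Continuous fun v : {v : Fin n → Fin n → ℝ // LinearIndependent ℝ v} =>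
      frameFlag ⟨_, linearIndependent_mulVec g v.2⟩ := by
    refine continuous_frameFlag.comp (Continuous.subtype_mk (continuous_pi fun m => ?_) _)
    exact Continuous.matrix_mulVec continuous_const
      ((continuous_apply m).comp continuous_subtype_val)
  exact h.congr fun v => (smul_frameFlag g v).symm

end Frames

end FlagRigidity

namespace FlagRigidity

/-! ### Maps of subspaces induced by fibration-preserving maps -/

/-- `Ψ` sends the flags of the frames in `O` to flags. -/
structure IncidenceMap {n : ℕ} (O : Set (Fin n → Fin n → ℝ))
    (Ψ : ℕ → Submodule ℝ (Fin n → ℝ) → Submodule ℝ (Fin n → ℝ)) : Prop where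
  linearIndependent : ∀ v ∈ O, LinearIndependent ℝ v
  finrank_eq : ∀ v ∈ O, ∀ d, 1 ≤ d → d < n → Module.finrank ℝ (Ψ d (spanLT v d)) = d
  mono : ∀ v ∈ O, ∀ d e, 1 ≤ d → d ≤ e → e < n → Ψ d (spanLT v d) ≤ Ψ e (spanLT v e)

/-- Passing to plain submodules indexed by dimension removes the dependent types of the flag
components. The shift `d - 1` undoes the indexing by dimension minus one, and `⊥` is a default for
inputs of the wrong dimension. -/
theorem exists_incidenceMap {n : ℕ} {f : FlagManifold n → FlagManifold n}
    {V : Set (FlagManifold n)} (h : FibrationPreservingOn f V) :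
    ∃ Ψ, IncidenceMap (frameSet V) Ψ ∧
      ∀ v : {v : Fin n → Fin n → ℝ // LinearIndependent ℝ v}, frameFlag v ∈ V →
        ∀ j : Fin (n - 1), ((f (frameFlag v)).1 j).1 = Ψ (j + 1) (spanLT v.1 (j + 1)) := by
  choose F hF using h
  let Ψ : ℕ → Submodule ℝ (Fin n → ℝ) → Submodule ℝ (Fin n → ℝ) := fun d W =>
    if hd : d - 1 < n - 1 then
      if hW : Module.finrank ℝ W = d - 1 + 1 then (F ⟨d - 1, hd⟩ ⟨W, hW⟩).1 else ⊥
    else ⊥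
  have key : ∀ v : {v : Fin n → Fin n → ℝ // LinearIndependent ℝ v}, frameFlag v ∈ V →
      ∀ j : Fin (n - 1), ((f (frameFlag v)).1 j).1 = Ψ (j + 1) (spanLT v.1 (j + 1)) := by
    intro v hv j
    have h1 := hF j ((frameFlag v).1 j) ⟨frameFlag v, ⟨hv, rfl⟩, rfl⟩
    have h2 : Module.finrank ℝ (spanLT v.1 (j + 1)) = (j : ℕ) + 1 - 1 + 1 :=
      finrank_spanLT v.2 (by omega)
    have h3 : (j : ℕ) + 1 - 1 < n - 1 := j.2
    have h4 : Ψ (j + 1) (spanLT v.1 (j + 1)) = (F j ((frameFlag v).1 j)).1 := by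
      simp only [Ψ, h3, h2, dif_pos]
      rfl
    rw [h4]
    exact congrArg Subtype.val h1
  have key' : ∀ v : {v : Fin n → Fin n → ℝ // LinearIndependent ℝ v}, frameFlag v ∈ V →
      ∀ d (h1 : 1 ≤ d) (h2 : d < n), Ψ d (spanLT v.1 d) =
        ((f (frameFlag v)).1 ⟨d - 1, by omega⟩).1 := by
    intro v hv d h1 h2
    rw [key v hv]
    simp only [Nat.sub_add_cancel h1]
  refine ⟨Ψ, ⟨fun v hv => hv.1, ?_, ?_⟩, key⟩
  · rintro v ⟨hv, hvV⟩ d h1 h2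
    rw [key' ⟨v, hv⟩ hvV d h1 h2, ((f (frameFlag ⟨v, hv⟩)).1 _).2]
    exact Nat.sub_add_cancel h1
  · rintro v ⟨hv, hvV⟩ d e h1 h2 h3
    rw [key' ⟨v, hv⟩ hvV d h1 (by omega), key' ⟨v, hv⟩ hvV e (by omega) h3]
    exact (f (frameFlag ⟨v, hv⟩)).2 _ _ (by rw [Fin.mk_le_mk]; omega)

theorem FibrationPreservingOn.mono {n : ℕ} {f : FlagManifold n → FlagManifold n}
    {V V' : Set (FlagManifold n)} (h : FibrationPreservingOn f V) (hV : V' ⊆ V) :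
    FibrationPreservingOn f V' := fun j W =>
  (h j W).imp fun _ hW => (image_mono (inter_subset_inter_left _ hV)).trans hW

theorem fibrationPreservingOn_iff {n : ℕ} {f : FlagManifold n → FlagManifold n}
    {V : Set (FlagManifold n)} :
    FibrationPreservingOn f V ↔
      ∀ j, ∀ x ∈ V, ∀ y ∈ V, proj j x = proj j y → proj j (f x) = proj j (f y) := by
  constructor
  · intro h j x hx y hy hxy
    obtain ⟨W', hW'⟩ := h j (proj j x)
    have h1 : proj j (f x) = W' := hW' ⟨x, ⟨hx, rfl⟩, rfl⟩
    have h2 : proj j (f y) = W' := hW' ⟨y, ⟨hy, hxy.symm⟩, rfl⟩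
    rw [h1, h2]
  · intro h j W
    by_cases hW : (V ∩ proj j ⁻¹' {W}).Nonempty
    · obtain ⟨x, hx, hxW⟩ := hW
      refine ⟨proj j (f x), ?_⟩
      rintro _ ⟨y, ⟨hy, hyW⟩, rfl⟩
      exact h j y hy x hx (Eq.trans hyW (Eq.symm hxW))
    · rw [not_nonempty_iff_eq_empty] at hW
      exact ⟨W, by rw [hW, image_empty]; exact empty_subset _⟩

theorem proj_smul {n : ℕ} (g : GL (Fin n) ℝ) (j : Fin (n - 1)) (x : FlagManifold n) :
    proj j (g • x) = g • proj j x :=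
  rfl

theorem FibrationPreservingOn.smul_comp {n : ℕ} {f : FlagManifold n → FlagManifold n}
    {V : Set (FlagManifold n)} (h : FibrationPreservingOn f V) (g g' : GL (Fin n) ℝ) :
    FibrationPreservingOn (fun x => g' • f (g • x)) {x | g • x ∈ V} := by
  rw [fibrationPreservingOn_iff] at h ⊢
  intro j x hx y hy hxy
  have := h j _ hx _ hy (by rw [proj_smul, proj_smul, hxy])
  rw [proj_smul, proj_smul, this]

/-! ### Spans of initial segments -/

section Spans

variable {m : ℕ}

theorem spanLT_one (v : Fin (m + 3) → Fin (m + 3) → ℝ) :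
    spanLT v 1 = Submodule.span ℝ {v 0} := by
  refine le_antisymm ((spanLT_le_iff _ _ _).2 fun k hk => ?_) ?_
  · have : k = 0 := Fin.ext (by simpa using hk)
    rw [this]
    exact Submodule.mem_span_singleton_self _
  · rw [Submodule.span_singleton_le_iff_mem]
    exact mem_spanLT v (by simp)

theorem spanLT_two (v : Fin (m + 3) → Fin (m + 3) → ℝ) :
    spanLT v 2 = Submodule.span ℝ {v 0, v 1} := by
  refine le_antisymm ((spanLT_le_iff _ _ _).2 fun k hk => ?_) ?_
  · have : k = 0 ∨ k = 1 := by
      rcases (by omega : (k : ℕ) = 0 ∨ (k : ℕ) = 1) with h | h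
      · exact Or.inl (Fin.ext (by simpa using h))
      · exact Or.inr (Fin.ext (by simpa using h))
    rcases this with rfl | rfl
    · exact Submodule.subset_span (by simp)
    · exact Submodule.subset_span (by simp)
  · rw [Submodule.span_le]
    rintro _ (rfl | rfl)
    · exact mem_spanLT v (by simp)
    · exact mem_spanLT v (by simp)

theorem span_pair_add_smul {E : Type*} [AddCommGroup E] [Module ℝ E] (p q : E) (s : ℝ) :
    Submodule.span ℝ {p + s • q, q} = Submodule.span ℝ {p, q} := by
  refine le_antisymm ?_ ?_ <;> rw [Submodule.span_le] <;> rintro _ (rfl | rfl)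
  · exact Submodule.mem_span_pair.2 ⟨1, s, by simp⟩
  · exact Submodule.mem_span_pair.2 ⟨0, 1, by simp⟩
  · exact Submodule.mem_span_pair.2 ⟨1, -s, by simp⟩
  · exact Submodule.mem_span_pair.2 ⟨0, 1, by simp⟩

theorem spanLT_update_zero_add {v : Fin (m + 3) → Fin (m + 3) → ℝ} {k : Fin (m + 3)}
    (hk : k ≠ 0) {d : ℕ} (hd : (k : ℕ) < d) (s : ℝ) :
    spanLT (Function.update v 0 (v 0 + s • v k)) d = spanLT v d := by
  have h0 : ((0 : Fin (m + 3)) : ℕ) < d := by simp; omega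
  refine le_antisymm ((spanLT_le_iff _ _ _).2 fun i hi => ?_)
    ((spanLT_le_iff _ _ _).2 fun i hi => ?_)
  · by_cases h : i = 0
    · subst h
      rw [Function.update_self]
      exact Submodule.add_mem _ (mem_spanLT v h0) (Submodule.smul_mem _ _ (mem_spanLT v hd))
    · rw [Function.update_of_ne h]
      exact mem_spanLT v hi
  · set w := Function.update v 0 (v 0 + s • v k) with hw
    have hwk : w k = v k := Function.update_of_ne hk _ _
    have hw0 : w 0 = v 0 + s • v k := Function.update_self _ _ _
    by_cases h : i = 0
    · subst h
      have : v 0 = w 0 - s • w k := by rw [hwk, hw0]; abel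
      rw [this]
      exact Submodule.sub_mem _ (mem_spanLT w h0) (Submodule.smul_mem _ _ (mem_spanLT w hd))
    · have : v i = w i := (Function.update_of_ne h _ _).symm
      rw [this]
      exact mem_spanLT w hi

end Spans

/-! ### Propagation of the identity along incidences -/

section Propagation

variable {m : ℕ} {O : Set (Fin (m + 3) → Fin (m + 3) → ℝ)}
  {Ψ : ℕ → Submodule ℝ (Fin (m + 3) → ℝ) → Submodule ℝ (Fin (m + 3) → ℝ)}

/-- If lines near `v 0` are fixed, all members of the flag of the frame `v` are fixed. -/
theorem IncidenceMap.fixes_spanLT (hΨ : IncidenceMap O Ψ) (hO : IsOpen O)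
    {v : Fin (m + 3) → Fin (m + 3) → ℝ} (hv : v ∈ O)
    (hfix : ∀ᶠ p in 𝓝 (v 0), Ψ 1 (Submodule.span ℝ {p}) = Submodule.span ℝ {p})
    {d : ℕ} (h1 : 1 ≤ d) (h2 : d < m + 3) : Ψ d (spanLT v d) = spanLT v d := by
  symm
  have h0 : v 0 ∈ Ψ d (spanLT v d) := by
    have := hΨ.mono v hv 1 d le_rfl h1 h2
    rw [spanLT_one, hfix.self_of_nhds] at this
    exact this (Submodule.mem_span_singleton_self _)
  refine Submodule.eq_of_le_of_finrank_eq ((spanLT_le_iff _ _ _).2 fun k hk => ?_) ?_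
  · by_cases hk0 : k = 0
    · rwa [hk0]
    · have hc1 : Continuous fun s : ℝ => v 0 + s • v k := by fun_prop
      have hc2 : Continuous fun s : ℝ => Function.update v 0 (v 0 + s • v k) :=
        continuous_const.update 0 hc1
      have e1 : ∀ᶠ s in 𝓝 (0 : ℝ), Ψ 1 (Submodule.span ℝ {v 0 + s • v k}) =
          Submodule.span ℝ {v 0 + s • v k} :=
        hc1.tendsto' 0 (v 0) (by simp) hfix
      have e2 : ∀ᶠ s in 𝓝 (0 : ℝ), Function.update v 0 (v 0 + s • v k) ∈ O :=
        hc2.tendsto' 0 v (by simp) (hO.mem_nhds hv)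
      -- For small `s ≠ 0` the line of `v 0 + s • v k` is fixed and lies in the same member of the
      -- flag. Subtracting `v 0` and dividing by `s` puts `v k` into the image.
      obtain ⟨s, ⟨hs1, hs2⟩, hs0⟩ := (((e1.and e2).filter_mono nhdsWithin_le_nhds).and
        (self_mem_nhdsWithin : ∀ᶠ s in 𝓝[≠] (0 : ℝ), s ∈ ({0}ᶜ : Set ℝ))).exists
      have := hΨ.mono _ hs2 1 d le_rfl h1 h2
      rw [spanLT_one, Function.update_self, hs1, spanLT_update_zero_add hk0 hk] at this
      have h3 := Submodule.sub_mem _ (this (Submodule.mem_span_singleton_self _)) h0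
      rw [add_sub_cancel_left] at h3
      exact (Submodule.smul_mem_iff _ hs0).1 h3
  · rw [hΨ.finrank_eq v hv d h1 h2, finrank_spanLT (hΨ.linearIndependent v hv) (by omega)]

/-- For `q` near `v 1` the plane of `v 0` and `q` contains `v 0 + s • q`, near which lines are
fixed, so the plane is fixed and contains the image of the line of `v 0`. Two such planes, for `v 1`
and `v 1 + t • v 2` with `t ≠ 0`, meet only in that line. -/
theorem IncidenceMap.fixes_of_add_smul (hΨ : IncidenceMap O Ψ) (hO : IsOpen O)
    {v : Fin (m + 3) → Fin (m + 3) → ℝ} (hv : v ∈ O) (s : ℝ)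
    (hvs : Function.update v 0 (v 0 + s • v 1) ∈ O)
    (hfix : ∀ᶠ p in 𝓝 (v 0 + s • v 1), Ψ 1 (Submodule.span ℝ {p}) = Submodule.span ℝ {p}) :
    Ψ 1 (Submodule.span ℝ {v 0}) = Submodule.span ℝ {v 0} := by
  have hli := hΨ.linearIndependent v hv
  -- lines through `v 0` and points near `v 0 + s • v 1` are fixed
  have hline : ∀ᶠ q in 𝓝 (v 1), Ψ 1 (Submodule.span ℝ {v 0}) ≤ Submodule.span ℝ {v 0, q} := by
    have hc1 : Continuous fun q : Fin (m + 3) → ℝ => v 0 + s • q := by fun_prop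
    have hc2 : Continuous fun q : Fin (m + 3) → ℝ => Function.update v 1 q :=
      continuous_const.update 1 continuous_id
    have hc3 : Continuous fun q : Fin (m + 3) → ℝ =>
        Function.update (Function.update v 1 q) 0 (v 0 + s • q) := hc2.update 0 hc1
    have e1 := (hc1.tendsto (v 1)).eventually hfix.eventually_nhds
    have e2 : ∀ᶠ q in 𝓝 (v 1), Function.update v 1 q ∈ O :=
      hc2.tendsto' _ v (by simp) (hO.mem_nhds hv)
    have e3 : ∀ᶠ q in 𝓝 (v 1), Function.update (Function.update v 1 q) 0 (v 0 + s • q) ∈ O :=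
      hc3.tendsto' _ _ (by simp) (hO.mem_nhds hvs)
    filter_upwards [e1, e2, e3] with q h1 h2 h3
    have h4 := hΨ.fixes_spanLT hO h3 (d := 2) (by simpa using h1) (by omega) (by omega)
    have h6 := hΨ.mono _ h2 1 2 le_rfl (by omega) (by omega)
    rw [spanLT_one, spanLT_two] at h6
    rw [spanLT_two] at h4
    simp only [Function.update_self, ne_eq, one_ne_zero, zero_ne_one, not_false_eq_true,
      Function.update_of_ne, span_pair_add_smul] at h4 h6
    rwa [h4] at h6
  have hc : Continuous fun t : ℝ => v 1 + t • v 2 := by fun_prop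
  have hline' : ∀ᶠ t in 𝓝 (0 : ℝ), Ψ 1 (Submodule.span ℝ {v 0}) ≤
      Submodule.span ℝ {v 0, v 1 + t • v 2} := hc.tendsto' 0 (v 1) (by simp) hline
  obtain ⟨t, ht, ht0⟩ := ((hline'.filter_mono nhdsWithin_le_nhds).and
    (self_mem_nhdsWithin : ∀ᶠ s in 𝓝[≠] (0 : ℝ), s ∈ ({0}ᶜ : Set ℝ))).exists
  refine Submodule.eq_of_le_of_finrank_eq (fun u hu => ?_) ?_
  · obtain ⟨a, b, hab⟩ := Submodule.mem_span_pair.1 (hline.self_of_nhds hu)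
    obtain ⟨a', b', hab'⟩ := Submodule.mem_span_pair.1 (ht hu)
    -- The coefficients of the difference of the two expressions for `u`, one in each plane.
    -- Independence gives `b' * t = 0`, hence `b' = 0`.
    have hsum : ∑ k, (Function.update (Function.update (Function.update
        (0 : Fin (m + 3) → ℝ) 0 (a - a')) 1 (b - b')) 2 (-(b' * t))) k • v k = 0 := by
      have h20 : (2 : Fin (m + 3)) ≠ 0 := by simp [Fin.ext_iff, Nat.mod_eq_of_lt]
      have h21 : (2 : Fin (m + 3)) ≠ 1 := by simp [Fin.ext_iff, Nat.mod_eq_of_lt]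
      rw [← Finset.sum_subset (Finset.subset_univ {0, 1, 2})]
      · rw [Finset.sum_insert (by simp [h20.symm]), Finset.sum_insert (by simp [h21.symm]),
          Finset.sum_singleton]
        simp only [Function.update_self, ne_eq, h20.symm, h21.symm, zero_ne_one,
          not_false_eq_true, Function.update_of_ne]
        have : a • v 0 + b • v 1 - (a' • v 0 + b' • (v 1 + t • v 2)) = 0 := by
          rw [hab, hab', sub_self]
        rw [← this]
        module
      · intro k _ hk
        simp only [Finset.mem_insert, Finset.mem_singleton, not_or] at hk
        simp [Function.update_of_ne, hk.1, hk.2.1, hk.2.2]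
    have h2 := Fintype.linearIndependent_iff.1 hli _ hsum 2
    have h1 := Fintype.linearIndependent_iff.1 hli _ hsum 1
    have h21 : (1 : Fin (m + 3)) ≠ 2 := by simp [Fin.ext_iff, Nat.mod_eq_of_lt]
    rw [Function.update_self] at h2
    rw [Function.update_of_ne h21, Function.update_self] at h1
    have hb' : b' = 0 := by
      rcases mul_eq_zero.1 (neg_eq_zero.1 h2) with h | h
      · exact h
      · exact absurd h ht0
    rw [← hab', hb', zero_smul, add_zero]
    exact Submodule.mem_span_singleton.2 ⟨a', rfl⟩
  · have := hΨ.finrank_eq v hv 1 le_rfl (by omega)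
    rw [spanLT_one] at this
    rw [this, finrank_span_singleton (hli.ne_zero 0)]

theorem IncidenceMap.eventually_fixes_of_add_smul (hΨ : IncidenceMap O Ψ) (hO : IsOpen O)
    {v : Fin (m + 3) → Fin (m + 3) → ℝ} (hv : v ∈ O) (s : ℝ)
    (hvs : Function.update v 0 (v 0 + s • v 1) ∈ O)
    (hfix : ∀ᶠ p in 𝓝 (v 0 + s • v 1), Ψ 1 (Submodule.span ℝ {p}) = Submodule.span ℝ {p}) :
    ∀ᶠ p in 𝓝 (v 0), Ψ 1 (Submodule.span ℝ {p}) = Submodule.span ℝ {p} := by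
  have hc1 : Continuous fun p : Fin (m + 3) → ℝ => p + s • v 1 := by fun_prop
  have hc2 : Continuous fun p : Fin (m + 3) → ℝ => Function.update v 0 p :=
    continuous_const.update 0 continuous_id
  have hc3 : Continuous fun p : Fin (m + 3) → ℝ => Function.update v 0 (p + s • v 1) :=
    continuous_const.update 0 hc1
  have e1 := (hc1.tendsto (v 0)).eventually hfix.eventually_nhds
  have e2 : ∀ᶠ p in 𝓝 (v 0), Function.update v 0 p ∈ O :=
    hc2.tendsto' _ v (by simp) (hO.mem_nhds hv)
  have e3 : ∀ᶠ p in 𝓝 (v 0), Function.update v 0 (p + s • v 1) ∈ O :=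
    hc3.tendsto' _ _ rfl (hO.mem_nhds hvs)
  filter_upwards [e1, e2, e3] with p h1 h2 h3
  have := hΨ.fixes_of_add_smul hO h2 s (by simpa using h3) (by simpa using h1)
  simpa using this

/-- Single moves go only in directions near `c 1`, but two suffice for any small displacement: go
from `p'` to `p' + s • c 1` and return to `p` along `s • q`, where `q = c 1 + s⁻¹ • (p' - p)` is
close to `c 1`. The radius depends only on `c`, which the closedness argument in
`eqOn_id_of_eventually` needs. -/
theorem IncidenceMap.exists_radius_fixes (hΨ : IncidenceMap O Ψ) (hO : IsOpen O)
    {c : Fin (m + 3) → Fin (m + 3) → ℝ} (hc : c ∈ O) :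
    ∃ η > 0, Metric.ball c η ⊆ O ∧ ∀ p ∈ Metric.ball (c 0) η, ∀ p' ∈ Metric.ball (c 0) η,
      (∀ᶠ x in 𝓝 p', Ψ 1 (Submodule.span ℝ {x}) = Submodule.span ℝ {x}) →
      ∀ᶠ x in 𝓝 p, Ψ 1 (Submodule.span ℝ {x}) = Submodule.span ℝ {x} := by
  obtain ⟨ε, hε, hball⟩ := Metric.isOpen_iff.1 hO c hc
  have hN : 0 < ‖c 1‖ + 1 := by positivity
  -- This makes `s • c 1` of norm at most `ε / 4`; the `+ 1` keeps the denominator positive.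
  set s : ℝ := ε / (4 * (‖c 1‖ + 1)) with hs
  have hs0 : 0 < s := by positivity
  have hs1 : ‖s • c 1‖ ≤ ε / 4 := by
    rw [norm_smul, Real.norm_of_nonneg hs0.le, hs, div_mul_eq_mul_div, div_le_div_iff₀
      (by positivity) (by positivity)]
    nlinarith [norm_nonneg (c 1)]
  -- The first bound keeps `p' + s • c 1` within `ε` of `c 0`. The second gives `s⁻¹ * ‖p' - p‖ < 2
  -- * η / s ≤ ε / 2`, so that `q` stays within `ε` of `c 1`.
  set η : ℝ := min (ε / 2) (s * ε / 4) with hη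
  have hη0 : 0 < η := by positivity
  have hη1 : η ≤ ε / 2 := min_le_left _ _
  have hη2 : η ≤ s * ε / 4 := min_le_right _ _
  have hmem : ∀ p q, dist p (c 0) < ε → dist q (c 1) < ε →
      Function.update (Function.update c 1 q) 0 p ∈ O := by
    intro p q hp hq
    refine hball ?_
    rw [Metric.mem_ball, dist_pi_lt_iff hε]
    intro i
    by_cases h0 : i = 0
    · subst h0
      simpa using hp
    · rw [Function.update_of_ne h0]
      by_cases h1 : i = 1
      · subst h1
        simpa using hq
      · rw [Function.update_of_ne h1, dist_self]
        exact hε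
  refine ⟨η, hη0, (Metric.ball_subset_ball (by linarith)).trans hball, ?_⟩
  intro p hp p' hp' hfix
  rw [Metric.mem_ball] at hp hp'
  have hmid : dist (p' + s • c 1) (c 0) < ε := by
    rw [dist_eq_norm] at hp' ⊢
    have : p' + s • c 1 - c 0 = (p' - c 0) + s • c 1 := by abel
    rw [this]
    linarith [norm_add_le (p' - c 0) (s • c 1)]
  have step1 : ∀ᶠ x in 𝓝 (p' + s • c 1),
      Ψ 1 (Submodule.span ℝ {x}) = Submodule.span ℝ {x} := by
    have := hΨ.eventually_fixes_of_add_smul hO (hmem (p' + s • c 1) (c 1) hmid (by simpa)) (-s)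
      (by simpa using hmem p' (c 1) (by linarith) (by simpa)) (by simpa using hfix)
    simpa using this
  set q : Fin (m + 3) → ℝ := c 1 + s⁻¹ • (p' - p) with hq
  have hqd : dist q (c 1) < ε := by
    rw [dist_eq_norm, hq, add_sub_cancel_left, norm_smul, norm_inv, Real.norm_of_nonneg hs0.le,
      inv_mul_lt_iff₀ hs0]
    have : ‖p' - p‖ < 2 * η := by
      rw [← dist_eq_norm]
      linarith [dist_triangle_right p' p (c 0)]
    nlinarith
  have hpq : p + s • q = p' + s • c 1 := by
    rw [hq, smul_add, smul_smul, mul_inv_cancel₀ hs0.ne', one_smul]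
    abel
  have := hΨ.eventually_fixes_of_add_smul hO (hmem p q (by linarith) hqd) s
    (by simpa [hpq] using hmem (p' + s • c 1) q hmid hqd) (by simpa [hpq] using step1)
  simpa using this

end Propagation

/-! ### Unique continuation -/

/-- The set `Ω` of flags near which `f` is the identity is open, and it is closed in `U`: around a
limit point, lines fixed near one frame in the ball of `exists_radius_fixes` force lines to be fixed
near every frame in it, and then whole flags are fixed. -/
theorem eqOn_id_of_eventually {m : ℕ} {U : Set (FlagManifold (m + 3))} (hUc : IsPreconnected U)
    {f : FlagManifold (m + 3) → FlagManifold (m + 3)} (hfib : LocallyFibrationPreservingOn f U)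
    {x₀ : FlagManifold (m + 3)} (hx₀ : x₀ ∈ U) (h₀ : ∀ᶠ x in 𝓝 x₀, f x = x) :
    ∀ x ∈ U, f x = x := by
  set Ω : Set (FlagManifold (m + 3)) := {x | ∀ᶠ y in 𝓝 x, f y = y} with hΩ
  have hΩo : IsOpen Ω := isOpen_iff_mem_nhds.2 fun x hx => hx.eventually_nhds
  have hsub : U ⊆ Ω := by
    refine hUc.subset_of_closure_inter_subset hΩo ⟨x₀, hx₀, h₀⟩ ?_
    rintro x ⟨hxc, hxU⟩
    obtain ⟨V, hVo, hxV, hVU, hV⟩ := hfib x hxU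
    obtain ⟨Ψ, hΨ, hΨf⟩ := exists_incidenceMap hV
    obtain ⟨c, rfl⟩ := frameFlag_surjective x
    have hO := isOpen_frameSet hVo
    obtain ⟨η, hη, hηO, hprop⟩ := hΨ.exists_radius_fixes hO (c := c.1) ⟨c.2, hxV⟩
    have hB : frameFlag '' (Subtype.val ⁻¹' Metric.ball c.1 η) ∈ 𝓝 (frameFlag c) :=
      (isOpenMap_frameFlag _ (Metric.isOpen_ball.preimage continuous_subtype_val)).mem_nhds
        ⟨c, Metric.mem_ball_self hη, rfl⟩
    obtain ⟨_, ⟨w, hw, rfl⟩, hwΩ⟩ := mem_closure_iff_nhds.1 hxc _ hB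
    have hcoord : ∀ v ∈ Metric.ball c.1 η, v 0 ∈ Metric.ball (c.1 0) η := fun v hv =>
      lt_of_le_of_lt (dist_le_pi_dist v c.1 0) hv
    have hw0 : ∀ᶠ p in 𝓝 (w.1 0), Ψ 1 (Submodule.span ℝ {p}) = Submodule.span ℝ {p} := by
      have hc2 : Continuous fun p : Fin (m + 3) → ℝ => Function.update w.1 0 p :=
        continuous_const.update 0 continuous_id
      have hopen : IsOpen (frameSet (Ω ∩ V)) := isOpen_frameSet (hΩo.inter hVo)
      have hmem : w.1 ∈ frameSet (Ω ∩ V) := ⟨w.2, hwΩ, (hηO hw).2⟩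
      have e : ∀ᶠ p in 𝓝 (w.1 0), Function.update w.1 0 p ∈ frameSet (Ω ∩ V) :=
        hc2.tendsto' _ w.1 (by simp) (hopen.mem_nhds hmem)
      filter_upwards [e] with p hp
      obtain ⟨hli, hp1, hp2⟩ := hp
      have h1 := hΨf ⟨_, hli⟩ hp2 ⟨0, by omega⟩
      rw [show f (frameFlag ⟨_, hli⟩) = frameFlag ⟨_, hli⟩ from hp1.self_of_nhds] at h1
      change spanLT _ 1 = Ψ 1 (spanLT _ 1) at h1
      simp only [spanLT_one, Function.update_self] at h1
      exact h1.symm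
    filter_upwards [hB]
    rintro _ ⟨v, hv, rfl⟩
    refine Subtype.ext (funext fun j => Subtype.ext ?_)
    rw [hΨf v (hηO hv).2 j]
    exact hΨ.fixes_spanLT hO (hηO hv) (hprop _ (hcoord _ hv) _ (hcoord _ hw) hw0) (by omega)
      (by omega)
  exact fun x hx => (hsub hx).self_of_nhds

theorem eqOn_smul_of_eventually {m : ℕ} {U : Set (FlagManifold (m + 3))}
    (hUc : IsPreconnected U) {f : FlagManifold (m + 3) → FlagManifold (m + 3)}
    (hfib : LocallyFibrationPreservingOn f U) (g : GL (Fin (m + 3)) ℝ)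
    {x₀ : FlagManifold (m + 3)} (hx₀ : x₀ ∈ U) (h₀ : ∀ᶠ x in 𝓝 x₀, f x = g • x) :
    ∀ x ∈ U, f x = g • x := by
  have h := eqOn_id_of_eventually hUc (f := fun x => g⁻¹ • f x) ?_ hx₀ ?_
  · exact fun x hx => inv_smul_eq_iff.1 (h x hx)
  · intro x hx
    obtain ⟨V, hVo, hxV, hVU, hV⟩ := hfib x hx
    refine ⟨V, hVo, hxV, hVU, ?_⟩
    simpa using hV.smul_comp 1 g⁻¹
  · filter_upwards [h₀] with x hx
    rw [hx, inv_smul_smul]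

end FlagRigidity

namespace FlagRigidity

/-! ### Functional equations -/

/-- The value `l * T (u / l)` is the same for all `l` large enough for `u`, and it extends `T` to an
additive map on `ℝ`. This map is continuous at `0`, hence linear. -/
theorem exists_linear_of_local_additive {T : ℝ → ℝ} {δ : ℝ} (hδ : 0 < δ)
    (hc : ContinuousAt T 0)
    (hT : ∀ u v, |u| < δ → |v| < δ → |u + v| < δ → T (u + v) = T u + T v) :
    ∃ a, ∀ u, |u| < δ → T u = a * u := by
  have h0 : T 0 = 0 := by
    have := hT 0 0 (by simpa) (by simpa) (by simpa)
    rw [add_zero] at this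
    linarith
  have hmul : ∀ (k : ℕ) (u : ℝ), |k * u| < δ → T (k * u) = k * T u := by
    intro k
    induction k with
    | zero => intro u _; simp [h0]
    | succ k ih =>
      intro u hu
      have hk : |(k : ℝ) * u| < δ := by
        refine lt_of_le_of_lt ?_ hu
        rw [abs_mul, abs_mul]
        refine mul_le_mul_of_nonneg_right ?_ (abs_nonneg u)
        rw [Nat.abs_cast, Nat.abs_cast]
        exact_mod_cast Nat.le_succ k
      have h1 : |u| < δ := by
        refine lt_of_le_of_lt ?_ hu
        rw [abs_mul, Nat.abs_cast]
        exact le_mul_of_one_le_left (abs_nonneg u) (by exact_mod_cast Nat.succ_pos k)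
      push_cast at hu ⊢
      rw [add_mul, one_mul] at hu ⊢
      rw [hT _ _ hk h1 hu, ih u hk]
      ring
  have hcompat : ∀ (k l : ℕ) (u : ℝ), 0 < k → 0 < l → |u / k| < δ → |u / l| < δ →
      (k : ℝ) * T (u / k) = l * T (u / l) := by
    intro k l u hk hl h1 h2
    have hk' : (k : ℝ) ≠ 0 := by positivity
    have hl' : (l : ℝ) ≠ 0 := by positivity
    have e1 : u / k = l * (u / (k * l)) := by field_simp
    have e2 : u / l = k * (u / (k * l)) := by field_simp
    have t1 := hmul l (u / (k * l)) (e1 ▸ h1)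
    have t2 := hmul k (u / (k * l)) (e2 ▸ h2)
    rw [← e1] at t1
    rw [← e2] at t2
    rw [t1, t2]
    ring
  have hN : ∀ u : ℝ, ∃ k : ℕ, ∀ l : ℕ, k ≤ l → 0 < l → |u / l| < δ := by
    intro u
    obtain ⟨k, hk⟩ := exists_nat_gt (|u| / δ)
    refine ⟨k, fun l hl hl0 => ?_⟩
    have hl0' : (0 : ℝ) < l := by exact_mod_cast hl0
    have hl' : (k : ℝ) ≤ l := by exact_mod_cast hl
    rw [abs_div, abs_of_pos hl0', div_lt_iff₀ hl0', mul_comm]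
    rw [div_lt_iff₀ hδ] at hk
    exact hk.trans_le (mul_le_mul_of_nonneg_right hl' hδ.le)
  choose N hN using hN
  let L : ℝ → ℝ := fun u => ((N u + 1 : ℕ) : ℝ) * T (u / (N u + 1 : ℕ))
  have hL : ∀ (u : ℝ) (l : ℕ), N u ≤ l → 0 < l → L u = l * T (u / l) := fun u l hl hl0 =>
    hcompat _ _ _ (Nat.succ_pos _) hl0 (hN u _ (Nat.le_succ _) (Nat.succ_pos _)) (hN u l hl hl0)
  have hLT : ∀ u, |u| < δ → L u = T u := by
    intro u hu
    have := hcompat (N u + 1) 1 u (Nat.succ_pos _) one_pos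
      (hN u _ (Nat.le_succ _) (Nat.succ_pos _)) (by simpa)
    simpa [L] using this
  let A : ℝ →+ ℝ :=
    { toFun := L
      map_zero' := by rw [hLT 0 (by simpa), h0]
      map_add' := by
        intro u v
        set l := N u + N v + N (u + v) + 1 with hl
        have hl0 : 0 < l := by omega
        rw [hL u l (by omega) hl0, hL v l (by omega) hl0, hL (u + v) l (by omega) hl0, add_div,
          hT _ _ (hN u l (by omega) hl0) (hN v l (by omega) hl0)
            (by rw [← add_div]; exact hN (u + v) l (by omega) hl0)]
        ring }
  have hA : Continuous A := by
    refine continuous_of_continuousAt_zero A ?_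
    refine hc.congr ?_
    filter_upwards [Metric.ball_mem_nhds (0 : ℝ) hδ] with u hu
    exact (hLT u (by simpa using hu)).symm
  refine ⟨A 1, fun u hu => ?_⟩
  have := map_real_smul A hA u 1
  rw [smul_eq_mul, smul_eq_mul, mul_one] at this
  rw [← hLT u hu, mul_comm]
  exact this

/-- Let `T i j` express `Y i - Y j` through `ξ i - ξ j`. Adding differences through a third index
gives `T i k (u + v) = T i j u + T j k v`. Putting `u = 0` or `v = 0` makes `T` independent of the
indices, and the equation becomes Cauchy's. -/
theorem exists_common_slope {m : ℕ} {Y : (Fin (m + 3) → ℝ) → Fin (m + 3) → ℝ} {ε : ℝ}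
    (hε : 0 < ε) (hc : ContinuousAt Y 0) (h0 : Y 0 = 0)
    (h : ∀ i j, i ≠ j → ∀ ξ ξ' : Fin (m + 3) → ℝ, ‖ξ‖ < ε → ‖ξ'‖ < ε →
      ξ i - ξ j = ξ' i - ξ' j → Y ξ i - Y ξ j = Y ξ' i - Y ξ' j) :
    ∃ a, ∀ ξ : Fin (m + 3) → ℝ, ‖ξ‖ < ε / 2 → ∀ i j, Y ξ i - Y ξ j = a * (ξ i - ξ j) := by
  let T : Fin (m + 3) → Fin (m + 3) → ℝ → ℝ := fun i j u =>
    Y (Pi.single i u) i - Y (Pi.single i u) j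
  have hTY : ∀ i j, i ≠ j → ∀ (u : ℝ) (ξ : Fin (m + 3) → ℝ), |u| < ε → ‖ξ‖ < ε →
      ξ i - ξ j = u → Y ξ i - Y ξ j = T i j u := by
    intro i j hij u ξ hu hξ hξu
    refine h i j hij _ _ hξ (by rwa [Pi.norm_single]) ?_
    rw [hξu, Pi.single_eq_same, Pi.single_eq_of_ne hij.symm, sub_zero]
  have hadd : ∀ i j k, i ≠ j → j ≠ k → i ≠ k → ∀ u v, |u| < ε → |v| < ε → |u + v| < ε →
      T i k (u + v) = T i j u + T j k v := by
    intro i j k hij hjk hik u v hu hv huv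
    -- One vector realizes the three differences `u`, `v`, `u + v` at once; its entries are `u + v`,
    -- `v` and zeros, so it lies in the ball.
    set ξ : Fin (m + 3) → ℝ := Function.update (Pi.single i (u + v)) j v with hξ
    have hξi : ξ i = u + v := by rw [hξ, Function.update_of_ne hij, Pi.single_eq_same]
    have hξj : ξ j = v := Function.update_self _ _ _
    have hξk : ξ k = 0 := by rw [hξ, Function.update_of_ne hjk.symm, Pi.single_eq_of_ne hik.symm]
    have hn : ‖ξ‖ < ε := by
      rw [pi_norm_lt_iff hε]
      intro l
      by_cases hl : l = j
      · rw [hl, hξj]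
        exact hv
      · rw [hξ, Function.update_of_ne hl]
        exact lt_of_le_of_lt (norm_le_pi_norm _ l) (by rwa [Pi.norm_single])
    rw [← hTY i k hik (u + v) ξ huv hn (by rw [hξi, hξk, sub_zero]),
      ← hTY i j hij u ξ hu hn (by rw [hξi, hξj]; ring),
      ← hTY j k hjk v ξ hv hn (by rw [hξj, hξk, sub_zero])]
    ring
  have hT0 : ∀ i j, T i j 0 = 0 := by
    intro i j
    simp [T, h0]
  have hsnd : ∀ i j k, i ≠ j → i ≠ k → ∀ u, |u| < ε → T i j u = T i k u := by
    intro i j k hij hik u hu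
    by_cases hjk : j = k
    · rw [hjk]
    · have := hadd i j k hij hjk hik u 0 hu (by simpa) (by simpa)
      rw [hT0, add_zero, add_zero] at this
      exact this.symm
  have hfst : ∀ i j k, i ≠ k → j ≠ k → ∀ u, |u| < ε → T i k u = T j k u := by
    intro i j k hik hjk u hu
    by_cases hij : i = j
    · rw [hij]
    · have := hadd i j k hij hjk hik 0 u (by simpa) hu (by simpa)
      rw [hT0, zero_add, zero_add] at this
      exact this
  have h01 : (0 : Fin (m + 3)) ≠ 1 := zero_ne_one
  have hall : ∀ i j, i ≠ j → ∀ u, |u| < ε → T i j u = T 0 1 u := by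
    intro i j hij u hu
    -- A third index `k` links any pair to `(0, 1)` through `T i j = T i k = T 0 k = T 0 1`.
    obtain ⟨k, hk⟩ : ∃ k : Fin (m + 3), k ∉ ({i, 0} : Finset (Fin (m + 3))) := by
      by_contra! hcon
      have h1 : (Finset.univ : Finset (Fin (m + 3))).card ≤
          ({i, 0} : Finset (Fin (m + 3))).card :=
        Finset.card_le_card fun k _ => hcon k
      have h2 : ({i, 0} : Finset (Fin (m + 3))).card ≤ 2 := Finset.card_le_two
      rw [Finset.card_univ, Fintype.card_fin] at h1
      omega
    simp only [Finset.mem_insert, Finset.mem_singleton, not_or] at hk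
    rw [hsnd i j k hij (Ne.symm hk.1) u hu, hfst i 0 k (Ne.symm hk.1) (Ne.symm hk.2) u hu,
      hsnd 0 k 1 (Ne.symm hk.2) h01 u hu]
  have hTc : ContinuousAt (T 0 1) 0 := by
    have hs : Continuous fun u : ℝ => (Pi.single 0 u : Fin (m + 3) → ℝ) :=
      continuous_single (A := fun _ : Fin (m + 3) => ℝ) 0
    have h1 : ContinuousAt (fun u : ℝ => Y (Pi.single 0 u : Fin (m + 3) → ℝ)) 0 :=
      ContinuousAt.comp (g := Y) (by simpa using hc) hs.continuousAt
    exact ((continuous_apply 0).continuousAt.comp h1).sub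
      ((continuous_apply 1).continuousAt.comp h1)
  obtain ⟨a, ha⟩ := exists_linear_of_local_additive hε hTc (by
    intro u v hu hv huv
    have h21 : (2 : Fin (m + 3)) ≠ 1 := by simp [Fin.ext_iff, Nat.mod_eq_of_lt]
    have h20 : (2 : Fin (m + 3)) ≠ 0 := by simp [Fin.ext_iff, Nat.mod_eq_of_lt]
    rw [hadd 0 2 1 h20.symm h21 h01 u v hu hv huv, hall 0 2 h20.symm u hu, hall 2 1 h21 v hv])
  refine ⟨a, fun ξ hξ i j => ?_⟩
  by_cases hij : i = j
  · rw [hij]; ring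
  · have hd : |ξ i - ξ j| < ε := by
      have h1 := norm_le_pi_norm ξ i
      have h2 := norm_le_pi_norm ξ j
      rw [Real.norm_eq_abs] at h1 h2
      linarith [abs_sub (ξ i) (ξ j)]
    rw [hTY i j hij _ ξ hd (by linarith) rfl, hall i j hij _ hd, ha _ hd]

/-- If `a ≠ 0`, differentiating gives `d 0 * (1 + u) ^ (a - 1) + ε * d 1 * (1 + ε * u) ^ (a - 1) =
0`. At `u = 0` this reads `d 0 = -ε * d 1`, and `d ≠ 0` forces `d 1 ≠ 0`. So the two powers agree
near `0`, which for `a ≠ 1` and `u ≠ 0` would require `ε = 1`. -/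
theorem exponent_eq_zero_or_one {a ε : ℝ} (hε0 : 0 < ε) (hε1 : ε < 1) {d : Fin 3 → ℝ}
    (hd : d ≠ 0)
    (h : ∀ᶠ u in 𝓝 (0 : ℝ), d 0 * (1 + u) ^ a + d 1 * (1 + ε * u) ^ a + d 2 = 0) :
    a = 0 ∨ a = 1 := by
  by_contra! hcon
  obtain ⟨ha0, ha1⟩ := hcon
  have hpos : ∀ᶠ u in 𝓝 (0 : ℝ), 0 < 1 + u ∧ 0 < 1 + ε * u := by
    have c1 : Continuous fun u : ℝ => 1 + u := by fun_prop
    have c2 : Continuous fun u : ℝ => 1 + ε * u := by fun_prop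
    exact ((c1.tendsto' 0 1 (by simp)).eventually_const_lt one_pos).and
      ((c2.tendsto' 0 1 (by simp)).eventually_const_lt one_pos)
  have hder : ∀ᶠ u in 𝓝 (0 : ℝ),
      d 0 * (1 + u) ^ (a - 1) + ε * d 1 * (1 + ε * u) ^ (a - 1) = 0 := by
    filter_upwards [h.eventually_nhds, hpos] with u hu hup
    have h1 : HasDerivAt (fun u : ℝ => 1 + u) 1 u := (hasDerivAt_id u).const_add 1
    have h2 : HasDerivAt (fun u : ℝ => 1 + ε * u) ε u := by
      simpa using ((hasDerivAt_id u).const_mul ε).const_add 1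
    have h3 := (((h1.rpow_const (p := a) (Or.inl hup.1.ne')).const_mul (d 0)).add
      ((h2.rpow_const (p := a) (Or.inl hup.2.ne')).const_mul (d 1))).add_const (d 2)
    have h4 : HasDerivAt (fun _ : ℝ => (0 : ℝ)) 0 u := hasDerivAt_const u 0
    have h5 := h3.unique (h4.congr_of_eventuallyEq hu)
    have h6 : a * (d 0 * (1 + u) ^ (a - 1) + ε * d 1 * (1 + ε * u) ^ (a - 1)) = 0 := by
      rw [← h5]; ring
    exact (mul_eq_zero.1 h6).resolve_left ha0
  have hd0 : d 0 + ε * d 1 = 0 := by simpa using hder.self_of_nhds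
  have hd012 : d 0 + d 1 + d 2 = 0 := by simpa using h.self_of_nhds
  have hd1 : d 1 ≠ 0 := by
    intro h1
    refine hd (funext fun k => ?_)
    have h0 : d 0 = 0 := by simpa [h1] using hd0
    fin_cases k
    · exact h0
    · exact h1
    · simpa [h0, h1] using hd012
  obtain ⟨u, ⟨hu, hup⟩, hu0⟩ := (((hder.and hpos).filter_mono nhdsWithin_le_nhds).and
    (self_mem_nhdsWithin : ∀ᶠ s in 𝓝[≠] (0 : ℝ), s ∈ ({0}ᶜ : Set ℝ))).exists
  have h1 : ε * d 1 * ((1 + ε * u) ^ (a - 1) - (1 + u) ^ (a - 1)) = 0 := by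
    rw [show d 0 = -(ε * d 1) by linarith] at hu
    linarith
  have h2 : (1 + ε * u) ^ (a - 1) = (1 + u) ^ (a - 1) := by
    have := (mul_eq_zero.1 h1).resolve_left (mul_ne_zero hε0.ne' hd1)
    linarith
  have h3 := (Real.rpow_left_inj hup.2.le hup.1.le (sub_ne_zero.2 ha1)).1 h2
  have h4 : (1 - ε) * u = 0 := by linarith
  rcases mul_eq_zero.1 h4 with h5 | h5
  · linarith
  · exact hu0 h5

/-! ### Permuting frames -/

section Permute

variable {n : ℕ}

theorem spanLT_comp_swap (v : Fin n → Fin n → ℝ) {x y : Fin n} {d : ℕ} (hx : (x : ℕ) < d)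
    (hy : (y : ℕ) < d) : spanLT (v ∘ Equiv.swap x y) d = spanLT v d := by
  have key : ∀ k : Fin n, (k : ℕ) < d → ((Equiv.swap x y k : Fin n) : ℕ) < d := by
    intro k hk
    rcases eq_or_ne k x with rfl | h1
    · rwa [Equiv.swap_apply_left]
    · rcases eq_or_ne k y with rfl | h2
      · rwa [Equiv.swap_apply_right]
      · rwa [Equiv.swap_apply_of_ne_of_ne h1 h2]
  refine le_antisymm ((spanLT_le_iff _ _ _).2 fun k hk => mem_spanLT v (key k hk))
    ((spanLT_le_iff _ _ _).2 fun k hk => ?_)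
  have := mem_spanLT (v ∘ Equiv.swap x y) (key k hk)
  simpa using this

theorem spanLT_update_of_le (v : Fin n → Fin n → ℝ) {x : Fin n} {d : ℕ} (hx : d ≤ x)
    (w : Fin n → ℝ) : spanLT (Function.update v x w) d = spanLT v d := by
  rw [spanLT, spanLT]
  congr 1
  refine image_congr fun k hk => Function.update_of_ne ?_ _ _
  rintro rfl
  exact absurd hk (not_lt.2 hx)

theorem exists_perm_pair {a b i j : Fin n} (hab : a ≠ b) (hij : i ≠ j) :
    ∃ e : Equiv.Perm (Fin n), e a = i ∧ e b = j := by
  refine ⟨(Equiv.swap a i).trans (Equiv.swap (Equiv.swap a i b) j), ?_, ?_⟩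
  · rw [Equiv.trans_apply, Equiv.swap_apply_left, Equiv.swap_apply_of_ne_of_ne _ hij]
    intro h
    have : Equiv.swap a i b = Equiv.swap a i a := by rw [← h, Equiv.swap_apply_left]
    exact hab ((Equiv.swap a i).injective this).symm
  · rw [Equiv.trans_apply, Equiv.swap_apply_left]

end Permute

end FlagRigidity

namespace FlagRigidity

/-! ### Local rigidity near a projective frame -/

section LocalRigidity

variable {m : ℕ} {O : Set (Fin (m + 3) → Fin (m + 3) → ℝ)}
  {Ψ : ℕ → Submodule ℝ (Fin (m + 3) → ℝ) → Submodule ℝ (Fin (m + 3) → ℝ)}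
  (P Q : Module.Basis (Fin (m + 3)) ℝ (Fin (m + 3) → ℝ))

/-- The tuple of those members of the projective frame `P_0, …, P_{n-1}, ∑ P_k` that are selected
by `σ`. -/
noncomputable def frameSelect (σ : Fin (m + 3) → Option (Fin (m + 3))) :
    Fin (m + 3) → Fin (m + 3) → ℝ :=
  fun k => (σ k).elim (∑ l, P l) P

variable {P}

theorem frameSelect_update (e : Equiv.Perm (Fin (m + 3))) (a : Fin (m + 3)) :
    frameSelect P (Function.update (fun k => some (e k)) a none) =
      Function.update (P ∘ e) a (∑ l, P l) := by
  funext k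
  by_cases h : k = a
  · subst h; simp [frameSelect]
  · simp [frameSelect, h]

theorem injective_update_none (e : Equiv.Perm (Fin (m + 3))) (a : Fin (m + 3)) :
    Function.Injective (Function.update (fun k => some (e k)) a none) := by
  intro k l hkl
  by_cases hk : k = a <;> by_cases hl : l = a
  · rw [hk, hl]
  · subst hk
    rw [Function.update_self, Function.update_of_ne hl] at hkl
    exact absurd hkl (by simp)
  · subst hl
    rw [Function.update_self, Function.update_of_ne hk] at hkl
    exact absurd hkl (by simp)
  · rw [Function.update_of_ne hk, Function.update_of_ne hl] at hkl
    exact e.injective (Option.some.inj hkl)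

theorem equivFun_symm_single (k : Fin (m + 3)) : P.equivFun.symm (Pi.single k 1) = P k := by
  simp [Module.Basis.equivFun_symm_apply, Pi.single_apply]

theorem equivFun_symm_one : P.equivFun.symm 1 = ∑ l, P l := by
  simp [Module.Basis.equivFun_symm_apply]

/-- The hyperplanes through a codimension two face of the simplex of the frame are mapped to
hyperplanes through the corresponding face. -/
theorem IncidenceMap.eventually_mem_hyperplane (hΨ : IncidenceMap O Ψ) (hO : IsOpen O)
    (hmem : ∀ σ, Function.Injective σ → frameSelect P σ ∈ O)
    (hPQ : ∀ k, Ψ 1 (Submodule.span ℝ {P k}) = Submodule.span ℝ {Q k})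
    {i j : Fin (m + 3)} {e : Equiv.Perm (Fin (m + 3))}
    (hei : e ⟨m + 1, by omega⟩ = i) (hej : e ⟨m + 2, by omega⟩ = j) :
    ∀ᶠ w in 𝓝 (∑ l, P l), ∃ Z : Submodule ℝ (Fin (m + 3) → ℝ),
      Z = Ψ (m + 2) (spanLT (Function.update (P ∘ e) ⟨m + 1, by omega⟩ w) (m + 2)) ∧
      Module.finrank ℝ Z = m + 2 ∧ (∀ k, k ≠ i → k ≠ j → Q k ∈ Z) ∧
      Ψ 1 (Submodule.span ℝ {w}) ≤ Z := by
  -- `e` puts `i` and `j` in the last two positions, so the first `m + 1` vectors span the face, and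
  -- replacing the vector at `a` by `w` yields the hyperplane through the face and `w`.
  set a : Fin (m + 3) := ⟨m + 1, by omega⟩ with ha
  have hc : Continuous fun w : Fin (m + 3) → ℝ => Function.update (P ∘ e) a w :=
    continuous_const.update a continuous_id
  have hcs : Continuous fun w : Fin (m + 3) → ℝ =>
      Function.update (P ∘ e) a w ∘ Equiv.swap 0 a :=
    continuous_pi fun k => (continuous_apply _).comp hc
  have e1 : ∀ᶠ w in 𝓝 (∑ l, P l), Function.update (P ∘ e) a w ∈ O := by
    refine hc.tendsto' _ _ rfl (hO.mem_nhds ?_)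
    rw [← frameSelect_update]
    exact hmem _ (injective_update_none e a)
  have e2 : ∀ᶠ w in 𝓝 (∑ l, P l), Function.update (P ∘ e) a w ∘ Equiv.swap 0 a ∈ O := by
    refine hcs.tendsto' _ _ rfl (hO.mem_nhds ?_)
    rw [← frameSelect_update]
    exact hmem (Function.update (fun k => some (e k)) a none ∘ Equiv.swap 0 a)
      ((injective_update_none e a).comp (Equiv.swap 0 a).injective)
  filter_upwards [e1, e2] with w h1 h2
  refine ⟨_, rfl, hΨ.finrank_eq _ h1 (m + 2) (by omega) (by omega), fun k hki hkj => ?_, ?_⟩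
  · have hκ : ((e.symm k : Fin (m + 3)) : ℕ) < m + 1 := by
      by_contra! hcon
      rcases (by omega : ((e.symm k : Fin (m + 3)) : ℕ) = m + 1 ∨
        ((e.symm k : Fin (m + 3)) : ℕ) = m + 2) with h | h
      · refine hki ?_
        rw [← hei, ← e.symm_apply_eq]
        exact Fin.ext h
      · refine hkj ?_
        rw [← hej, ← e.symm_apply_eq]
        exact Fin.ext h
    -- Reordering within the face moves `P k` to the front, which makes its line a member of the
    -- flag without changing the face.
    have h3 : (P ∘ e) ∘ Equiv.swap 0 (e.symm k) ∈ O := by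
      refine hmem (fun l => some (e (Equiv.swap 0 (e.symm k) l))) fun x y hxy => ?_
      exact (Equiv.swap 0 (e.symm k)).injective (e.injective (Option.some.inj hxy))
    have h4 := hΨ.mono _ h3 1 (m + 1) le_rfl (by omega) (by omega)
    rw [spanLT_one, spanLT_comp_swap _ (by simp) hκ] at h4
    simp only [Function.comp_apply, Equiv.swap_apply_left, Equiv.apply_symm_apply, hPQ] at h4
    have h5 := hΨ.mono _ h1 (m + 1) (m + 2) (by omega) (by omega) (by omega)
    rw [spanLT_update_of_le _ (by simp [ha])] at h5
    exact h5 (h4 (Submodule.mem_span_singleton_self _))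
  · have h4 := hΨ.mono _ h2 1 (m + 2) le_rfl (by omega) (by omega)
    rw [spanLT_one, spanLT_comp_swap _ (by simp) (by simp [ha])] at h4
    simpa using h4

/-- The vector `x - (x i / x' i) • x'` has vanishing coordinates at `i` and `j`, so it lies in the
face common to both hyperplanes. -/
theorem spanLT_update_le_of_ratio {i j : Fin (m + 3)} {e : Equiv.Perm (Fin (m + 3))}
    (hei : e ⟨m + 1, by omega⟩ = i) (hej : e ⟨m + 2, by omega⟩ = j)
    {x x' : Fin (m + 3) → ℝ} (hx' : x' i ≠ 0) (h : x i * x' j = x j * x' i) :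
    spanLT (Function.update (P ∘ e) ⟨m + 1, by omega⟩ (P.equivFun.symm x)) (m + 2) ≤
      spanLT (Function.update (P ∘ e) ⟨m + 1, by omega⟩ (P.equivFun.symm x')) (m + 2) := by
  set a : Fin (m + 3) := ⟨m + 1, by omega⟩ with ha
  set v' := Function.update (P ∘ e) a (P.equivFun.symm x') with hv'
  have hP : ∀ k : Fin (m + 3), k ≠ a → (k : ℕ) < m + 2 → P (e k) ∈ spanLT v' (m + 2) := by
    intro k hk hkm
    have := mem_spanLT v' hkm
    rwa [hv', Function.update_of_ne hk] at this
  rw [spanLT_le_iff]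
  intro k hk
  by_cases hka : k = a
  · subst hka
    rw [Function.update_self]
    have h1 : P.equivFun.symm x = (x i / x' i) • P.equivFun.symm x' +
        ∑ l, (x l - x i / x' i * x' l) • P l := by
      rw [← P.equivFun_symm_apply, ← map_smul, ← map_add]
      congr 1
      funext l
      simp
    rw [h1]
    refine Submodule.add_mem _ (Submodule.smul_mem _ _ ?_) (Submodule.sum_mem _ fun l _ => ?_)
    · have := mem_spanLT v' hk
      rwa [hv', Function.update_self] at this
    · by_cases hli : l = i
      · rw [hli, div_mul_cancel₀ _ hx', sub_self, zero_smul]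
        exact Submodule.zero_mem _
      · by_cases hlj : l = j
        · have : x j - x i / x' i * x' j = 0 := by
            field_simp
            linarith
          rw [hlj, this, zero_smul]
          exact Submodule.zero_mem _
        · refine Submodule.smul_mem _ _ ?_
          have h2 := hP (e.symm l) (fun h => hli ?_) ?_
          · simpa using h2
          · rw [← hei, ← h, Equiv.apply_symm_apply]
          · by_contra! hcon
            refine hlj ?_
            rw [← hej, ← e.symm_apply_eq]
            exact Fin.ext (by simp only; omega)
  · rw [Function.update_of_ne hka]
    exact hP k hka hk

variable {Q}

theorem eq_top_of_basis_mem {Z : Submodule ℝ (Fin (m + 3) → ℝ)} (h : ∀ k, Q k ∈ Z) : Z = ⊤ := by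
  rw [eq_top_iff, ← Q.span_eq, Submodule.span_le]
  rintro _ ⟨k, rfl⟩
  exact h k

/-- Modulo the vectors `Q k` in `Z`, only the coordinates at `i` and `j` matter. If their
determinant were nonzero, `Z` would contain `Q i` and `Q j` too, hence everything. -/
theorem mul_eq_mul_of_mem_hyperplane {Z : Submodule ℝ (Fin (m + 3) → ℝ)}
    (hZ : Module.finrank ℝ Z = m + 2) {i j : Fin (m + 3)} (hij : i ≠ j)
    (hQ : ∀ k, k ≠ i → k ≠ j → Q k ∈ Z) {y y' : Fin (m + 3) → ℝ}
    (hy : Q.equivFun.symm y ∈ Z) (hy' : Q.equivFun.symm y' ∈ Z) : y i * y' j = y j * y' i := by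
  by_contra hne
  have hd : y i * y' j - y j * y' i ≠ 0 := sub_ne_zero.2 hne
  have hred : ∀ z : Fin (m + 3) → ℝ, Q.equivFun.symm z ∈ Z → z i • Q i + z j • Q j ∈ Z := by
    intro z hz
    rw [Q.equivFun_symm_apply, ← Finset.add_sum_erase _ _ (Finset.mem_univ i),
      ← Finset.add_sum_erase _ _ (Finset.mem_erase.2 ⟨hij.symm, Finset.mem_univ j⟩),
      ← add_assoc] at hz
    refine (Submodule.add_mem_iff_left _ (Submodule.sum_mem _ fun k hk => ?_)).1 hz
    rw [Finset.mem_erase, Finset.mem_erase] at hk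
    exact Submodule.smul_mem _ _ (hQ k hk.2.1 hk.1)
  have h1 := hred y hy
  have h2 := hred y' hy'
  have hQi : Q i ∈ Z := by
    have : (y i * y' j - y j * y' i) • Q i ∈ Z := by
      have h3 := Z.sub_mem (Z.smul_mem (y' j) h1) (Z.smul_mem (y j) h2)
      convert h3 using 1
      module
    exact (Submodule.smul_mem_iff _ hd).1 this
  have hQj : Q j ∈ Z := by
    have : (y i * y' j - y j * y' i) • Q j ∈ Z := by
      have h3 := Z.sub_mem (Z.smul_mem (y i) h2) (Z.smul_mem (y' i) h1)
      convert h3 using 1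
      module
    exact (Submodule.smul_mem_iff _ hd).1 this
  have := eq_top_of_basis_mem (Q := Q) (Z := Z) fun k => by
    by_cases h1 : k = i
    · rwa [h1]
    · by_cases h2 : k = j
      · rwa [h2]
      · exact hQ k h1 h2
  rw [this, finrank_top, Module.finrank_fin_fun] at hZ
  omega

/-- Points with equal ratio span the same hyperplane with the face. Its image contains both image
lines and the face of the `Q k`, which fixes the ratio on the other side. -/
theorem IncidenceMap.ratio_eq (hΨ : IncidenceMap O Ψ) (hO : IsOpen O)
    (hmem : ∀ σ, Function.Injective σ → frameSelect P σ ∈ O)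
    (hPQ : ∀ k, Ψ 1 (Submodule.span ℝ {P k}) = Submodule.span ℝ {Q k})
    {y : (Fin (m + 3) → ℝ) → Fin (m + 3) → ℝ}
    (hy : ∀ᶠ x in 𝓝 1, Ψ 1 (Submodule.span ℝ {P.equivFun.symm x}) =
      Submodule.span ℝ {Q.equivFun.symm (y x)})
    {i j : Fin (m + 3)} (hij : i ≠ j) :
    ∃ N ∈ 𝓝 (1 : Fin (m + 3) → ℝ), ∀ x ∈ N, ∀ x' ∈ N, x i * x' j = x j * x' i →
      y x i * y x' j = y x j * y x' i := by
  obtain ⟨e, hei, hej⟩ := exists_perm_pair (a := (⟨m + 1, by omega⟩ : Fin (m + 3)))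
    (b := ⟨m + 2, by omega⟩) (by simp) hij
  have hX : Continuous fun x : Fin (m + 3) → ℝ => P.equivFun.symm x :=
    P.equivFun.symm.toLinearMap.continuous_of_finiteDimensional
  have e1 := (hX.tendsto' 1 _ equivFun_symm_one).eventually
    (hΨ.eventually_mem_hyperplane Q hO hmem hPQ hei hej)
  have e2 : ∀ᶠ x in 𝓝 (1 : Fin (m + 3) → ℝ), x i ≠ 0 :=
    (continuous_apply i).continuousAt.eventually_ne one_ne_zero
  refine ⟨_, (e1.and (e2.and hy)), ?_⟩
  rintro x ⟨⟨Z, hZ, hZr, hZQ, hZx⟩, hx0, hxy⟩ x' ⟨⟨Z', hZ', -, -, hZx'⟩, hx0', hxy'⟩ hxx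
  have hZZ : Z' = Z := by
    rw [hZ, hZ']
    congr 1
    exact le_antisymm (spanLT_update_le_of_ratio hei hej hx0 (by linarith))
      (spanLT_update_le_of_ratio hei hej hx0' hxx)
  rw [hZZ] at hZx'
  rw [hxy] at hZx
  rw [hxy'] at hZx'
  exact mul_eq_mul_of_mem_hyperplane hZr hij hZQ
    (hZx (Submodule.mem_span_singleton_self _)) (hZx' (Submodule.mem_span_singleton_self _))

/-- For `Y ξ = log (y (exp ξ))` the hypothesis says that `Y i - Y j` depends only on `ξ i - ξ j`. So
`exists_common_slope` yields `Y k = a * ξ k` plus a term independent of `k`, and exponentiating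
gives the powers. -/
theorem exists_rpow_of_ratio {y : (Fin (m + 3) → ℝ) → Fin (m + 3) → ℝ}
    (hyc : ContinuousAt y 1) (hy1 : y 1 = 1)
    (h : ∀ i j, i ≠ j → ∃ N ∈ 𝓝 (1 : Fin (m + 3) → ℝ), ∀ x ∈ N, ∀ x' ∈ N,
      x i * x' j = x j * x' i → y x i * y x' j = y x j * y x' i) :
    ∃ a : ℝ, ∀ᶠ x in 𝓝 (1 : Fin (m + 3) → ℝ), ∃ c : ℝ, c ≠ 0 ∧ ∀ k, y x k = c * x k ^ a := by
  choose! N hN hNy using h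
  have hpos : ∀ᶠ x in 𝓝 (1 : Fin (m + 3) → ℝ), ∀ k, 0 < y x k := by
    rw [eventually_all]
    intro k
    have : ContinuousAt (fun x => y x k) 1 := (continuous_apply k).continuousAt.comp hyc
    exact this.eventually_const_lt (by simp [hy1])
  have hxpos : ∀ᶠ x in 𝓝 (1 : Fin (m + 3) → ℝ), ∀ k, 0 < x k := by
    rw [eventually_all]
    intro k
    exact (continuous_apply k).continuousAt.eventually_const_lt (by simp)
  have hNall : ∀ᶠ x in 𝓝 (1 : Fin (m + 3) → ℝ), ∀ i j, i ≠ j → x ∈ N i j := by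
    rw [eventually_all]
    intro i
    rw [eventually_all]
    intro j
    by_cases hij : i = j
    · exact Eventually.of_forall fun x h => absurd hij h
    · filter_upwards [hN i j hij] with x hx _ using hx
  let E : (Fin (m + 3) → ℝ) → Fin (m + 3) → ℝ := fun ξ k => Real.exp (ξ k)
  have hE : Continuous E := continuous_pi fun k => Real.continuous_exp.comp (continuous_apply k)
  have hE0 : E 0 = 1 := by funext k; simp [E]
  obtain ⟨ε, hε, hball⟩ := Metric.eventually_nhds_iff.1
    (hE.tendsto' 0 1 hE0 (hpos.and hNall))
  simp only [dist_zero_right] at hball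
  let Y : (Fin (m + 3) → ℝ) → Fin (m + 3) → ℝ := fun ξ k => Real.log (y (E ξ) k)
  have hY0 : Y 0 = 0 := by funext k; simp [Y, hE0, hy1]
  have hYc : ContinuousAt Y 0 := by
    refine continuousAt_pi.2 fun k => ?_
    have h1 : ContinuousAt (fun ξ => y (E ξ)) 0 :=
      ContinuousAt.comp (g := y) (by rwa [hE0]) hE.continuousAt
    exact ((continuous_apply k).continuousAt.comp h1).log (by simp [hE0, hy1])
  obtain ⟨a, ha⟩ := exists_common_slope hε hYc hY0 (by
    intro i j hij ξ ξ' hξ hξ' hdiff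
    obtain ⟨hp, hn⟩ := hball hξ
    obtain ⟨hp', hn'⟩ := hball hξ'
    have h1 := hNy i j hij _ (hn i j hij) _ (hn' i j hij) (by
      simp only [E]
      rw [← Real.exp_add, ← Real.exp_add]
      congr 1
      linarith)
    have h2 := congrArg Real.log h1
    rw [Real.log_mul (hp i).ne' (hp' j).ne', Real.log_mul (hp j).ne' (hp' i).ne'] at h2
    simp only [Y]
    linarith)
  refine ⟨a, ?_⟩
  have hlogc : ContinuousAt (fun (x : Fin (m + 3) → ℝ) k => Real.log (x k)) 1 :=
    continuousAt_pi.2 fun k => (continuous_apply k).continuousAt.log (by simp)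
  have hlog : ∀ᶠ x in 𝓝 (1 : Fin (m + 3) → ℝ), ‖fun k => Real.log (x k)‖ < ε / 2 := by
    refine hlogc.norm.eventually_lt_const ?_
    have : (fun k => Real.log ((1 : Fin (m + 3) → ℝ) k)) = 0 := by funext k; simp
    change ‖fun k => Real.log ((1 : Fin (m + 3) → ℝ) k)‖ < ε / 2
    rw [this, norm_zero]
    positivity
  filter_upwards [hlog, hxpos, hpos] with x hx hx0 hy0
  have hEx : E (fun k => Real.log (x k)) = x := by
    funext k
    exact Real.exp_log (hx0 k)
  refine ⟨y x 0 / x 0 ^ a, (div_pos (hy0 0) (Real.rpow_pos_of_pos (hx0 0) a)).ne', fun k => ?_⟩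
  have h1 := ha _ hx k 0
  simp only [Y, hEx] at h1
  have h2 : Real.log (y x k) = Real.log (y x 0 / x 0 ^ a * x k ^ a) := by
    rw [Real.log_mul (div_pos (hy0 0) (Real.rpow_pos_of_pos (hx0 0) a)).ne'
      (Real.rpow_pos_of_pos (hx0 k) a).ne', Real.log_div (hy0 0).ne'
      (Real.rpow_pos_of_pos (hx0 0) a).ne', Real.log_rpow (hx0 0), Real.log_rpow (hx0 k)]
    linarith
  exact Real.log_injOn_pos (hy0 k) (mul_pos (div_pos (hy0 0) (Real.rpow_pos_of_pos (hx0 0) a))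
    (Real.rpow_pos_of_pos (hx0 k) a)) h2

/-- Lines near the unit point `S` in the plane of `S` and `q = P 0 + ε • P 1` go into one plane.
Hence the image coordinates `(1 + u) ^ a`, `(1 + ε * u) ^ a`, `1` satisfy a nontrivial linear
relation. -/
theorem IncidenceMap.exponent_eq_zero_or_one (hΨ : IncidenceMap O Ψ) (hO : IsOpen O)
    (hmem : ∀ σ, Function.Injective σ → frameSelect P σ ∈ O) {a : ℝ}
    (ha : ∀ᶠ x in 𝓝 (1 : Fin (m + 3) → ℝ), Ψ 1 (Submodule.span ℝ {P.equivFun.symm x}) =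
      Submodule.span ℝ {Q.equivFun.symm fun k => x k ^ a}) : a = 0 ∨ a = 1 := by
  set S : Fin (m + 3) → ℝ := ∑ l, P l with hS
  set v : Fin (m + 3) → Fin (m + 3) → ℝ := Fin.cons S fun k : Fin (m + 2) => P k.castSucc with hv
  have hv0 : v 0 = S := rfl
  have hv1 : v 1 = P 0 := rfl
  have hvO : v ∈ O := by
    have h1 : v = frameSelect P (Fin.cons none fun k : Fin (m + 2) => some k.castSucc) := by
      funext k
      refine Fin.cases ?_ (fun k => ?_) k
      · rfl
      · rfl
    rw [h1]
    refine hmem _ (Fin.cons_injective_iff.2 ⟨?_, ?_⟩)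
    · rintro ⟨k, hk⟩
      exact absurd hk (by simp)
    · exact fun k l hkl => Fin.castSucc_injective _ (Option.some.inj hkl)
  have hc1 : Continuous fun t : ℝ => Function.update v 1 (P 0 + t • P 1) :=
    continuous_const.update 1 (by fun_prop)
  have e1 : ∀ᶠ t in 𝓝 (0 : ℝ), Function.update v 1 (P 0 + t • P 1) ∈ O :=
    hc1.tendsto' 0 v (by simp [← hv1]) (hO.mem_nhds hvO)
  -- Only planes near that of `S` and `P 0` are available, so `P 0` is tilted slightly towards `P
  -- 1`. With `0 < ε < 1` the first three coordinates vary at three different rates.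
  obtain ⟨ε, ⟨hεO, hε1⟩, hε0⟩ := (((e1.and (eventually_lt_nhds one_pos)).filter_mono
    nhdsWithin_le_nhds).and (self_mem_nhdsWithin : ∀ᶠ s in 𝓝[>] (0 : ℝ), s ∈ Ioi (0 : ℝ))).exists
  set q := P 0 + ε • P 1 with hq
  set w := Function.update v 1 q with hw
  have hc2 : Continuous fun u : ℝ => Function.update w 0 (S + u • q) :=
    continuous_const.update 0 (by fun_prop)
  have hw0 : w 0 = S := by rw [hw, Function.update_of_ne zero_ne_one, hv0]
  have hw1 : w 1 = q := Function.update_self _ _ _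
  have e2 : ∀ᶠ u in 𝓝 (0 : ℝ), Function.update w 0 (S + u • q) ∈ O :=
    hc2.tendsto' 0 w (by simp [← hw0]) (hO.mem_nhds hεO)
  let x : ℝ → Fin (m + 3) → ℝ := fun u => 1 + u • (Pi.single 0 1 + ε • Pi.single 1 1)
  have hxc : Continuous x := by fun_prop
  have hxS : ∀ u, P.equivFun.symm (x u) = S + u • q := by
    intro u
    simp only [x, map_add, map_smul, equivFun_symm_one, equivFun_symm_single, hq, hS]
  have e3 := (hxc.tendsto' 0 1 (by simp [x])).eventually ha
  set Z := Ψ 2 (spanLT w 2) with hZ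
  have hZr : Module.finrank ℝ Z = 2 := hΨ.finrank_eq w hεO 2 (by omega) (by omega)
  have hmemZ : ∀ᶠ u in 𝓝 (0 : ℝ), (Q.equivFun.symm fun k => x u k ^ a) ∈ Z := by
    filter_upwards [e2, e3] with u h2 h3
    have h4 := hΨ.mono _ h2 1 2 le_rfl (by omega) (by omega)
    have h5 : spanLT (Function.update w 0 (S + u • q)) 2 = spanLT w 2 := by
      rw [spanLT_two, spanLT_two, Function.update_self, Function.update_of_ne one_ne_zero, hw0,
        hw1, span_pair_add_smul]
    rw [spanLT_one, h5, Function.update_self, ← hxS, h3] at h4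
    exact h4 (Submodule.mem_span_singleton_self _)
  let π : (Fin (m + 3) → ℝ) →ₗ[ℝ] (Fin 3 → ℝ) :=
    (LinearMap.funLeft ℝ ℝ (Fin.castLE (by omega) : Fin 3 → Fin (m + 3))).comp
      (Q.equivFun : (Fin (m + 3) → ℝ) →ₗ[ℝ] (Fin (m + 3) → ℝ))
  -- A plane cannot project onto three coordinates; a functional vanishing on the projection
  -- supplies the relation.
  have hlt : Z.map π < ⊤ := by
    refine lt_top_iff_ne_top.2 fun htop => ?_
    have h1 := Submodule.finrank_map_le π Z
    rw [htop, finrank_top, Module.finrank_fin_fun, hZr] at h1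
    omega
  obtain ⟨φ, hφ, hφZ⟩ := Submodule.exists_le_ker_of_lt_top _ hlt
  refine FlagRigidity.exponent_eq_zero_or_one hε0 hε1 (d := fun k => φ (Pi.single k 1)) ?_ ?_
  · intro h0
    refine hφ (LinearMap.pi_ext' fun k => LinearMap.ext_ring ?_)
    exact congrFun h0 k
  · filter_upwards [hmemZ] with u hu
    have h1 : φ (π (Q.equivFun.symm fun k => x u k ^ a)) = 0 :=
      hφZ (Submodule.mem_map_of_mem hu)
    have h2 : π (Q.equivFun.symm fun k => x u k ^ a) =
        ∑ k : Fin 3, (x u (Fin.castLE (by omega) k) ^ a) • Pi.single k 1 := by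
      funext k
      have h3 : π (Q.equivFun.symm fun k => x u k ^ a) k =
          Q.equivFun (Q.equivFun.symm fun k => x u k ^ a) (Fin.castLE (by omega) k) := rfl
      rw [h3, LinearEquiv.apply_symm_apply]
      simp [Finset.sum_apply, Pi.single_apply]
    have x0 : x u (Fin.castLE (by omega) (0 : Fin 3)) = 1 + u := by
      have : (Fin.castLE (by omega) (0 : Fin 3) : Fin (m + 3)) = 0 := rfl
      rw [this]
      simp [x]
    have x1 : x u (Fin.castLE (by omega) (1 : Fin 3)) = 1 + ε * u := by
      have : (Fin.castLE (by omega) (1 : Fin 3) : Fin (m + 3)) = 1 := rfl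
      rw [this]
      simp [x, mul_comm]
    have x2 : x u (Fin.castLE (by omega) (2 : Fin 3)) = 1 := by
      have : (Fin.castLE (by omega) (2 : Fin 3) : Fin (m + 3)) = 2 := rfl
      rw [this]
      have h20 : (2 : Fin (m + 3)) ≠ 0 := by simp [Fin.ext_iff, Nat.mod_eq_of_lt]
      have h21 : (2 : Fin (m + 3)) ≠ 1 := by simp [Fin.ext_iff, Nat.mod_eq_of_lt]
      simp [x, Pi.single_eq_of_ne, h20, h21]
    rw [h2, map_sum, Fin.sum_univ_three, x0, x1, x2] at h1
    simp only [map_smul, smul_eq_mul, Real.one_rpow, one_mul] at h1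
    linarith

/-- Exponent `0` sends every point to the unit point of `Q`; exponent `1` preserves coordinates and
is therefore the linear map `P k ↦ Q k`. -/
theorem IncidenceMap.locally_const_or_projective (hΨ : IncidenceMap O Ψ) (hO : IsOpen O)
    (hmem : ∀ σ, Function.Injective σ → frameSelect P σ ∈ O)
    (hPQ : ∀ k, Ψ 1 (Submodule.span ℝ {P k}) = Submodule.span ℝ {Q k})
    {u : (Fin (m + 3) → ℝ) → Fin (m + 3) → ℝ} (huc : ContinuousAt u (∑ l, P l))
    (hu : u (∑ l, P l) = ∑ l, Q l)
    (huΨ : ∀ᶠ p in 𝓝 (∑ l, P l), Ψ 1 (Submodule.span ℝ {p}) = Submodule.span ℝ {u p}) :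
    (∀ᶠ p in 𝓝 (∑ l, P l), Ψ 1 (Submodule.span ℝ {p}) = Submodule.span ℝ {∑ l, Q l}) ∨
      ∀ᶠ p in 𝓝 (∑ l, P l), Ψ 1 (Submodule.span ℝ {p}) =
        Submodule.span ℝ {P.equiv Q (Equiv.refl _) p} := by
  have hX : Continuous fun x : Fin (m + 3) → ℝ => P.equivFun.symm x :=
    P.equivFun.symm.toLinearMap.continuous_of_finiteDimensional
  have hXP : Continuous fun p : Fin (m + 3) → ℝ => P.equivFun p :=
    P.equivFun.toLinearMap.continuous_of_finiteDimensional
  have hXQ : Continuous fun p : Fin (m + 3) → ℝ => Q.equivFun p :=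
    Q.equivFun.toLinearMap.continuous_of_finiteDimensional
  let y : (Fin (m + 3) → ℝ) → Fin (m + 3) → ℝ := fun x => Q.equivFun (u (P.equivFun.symm x))
  have hy1 : y 1 = 1 := by
    simp only [y, equivFun_symm_one, hu]
    rw [← equivFun_symm_one, LinearEquiv.apply_symm_apply]
  have hyc : ContinuousAt y 1 := by
    refine hXQ.continuousAt.comp (ContinuousAt.comp (g := u) ?_ hX.continuousAt)
    rwa [equivFun_symm_one]
  have hy : ∀ᶠ x in 𝓝 1, Ψ 1 (Submodule.span ℝ {P.equivFun.symm x}) =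
      Submodule.span ℝ {Q.equivFun.symm (y x)} := by
    have := (hX.tendsto' 1 _ equivFun_symm_one).eventually huΨ
    filter_upwards [this] with x hx
    simp only [y, LinearEquiv.symm_apply_apply]
    exact hx
  obtain ⟨a, ha⟩ := exists_rpow_of_ratio hyc hy1 fun i j hij => hΨ.ratio_eq hO hmem hPQ hy hij
  have hΦ : ∀ᶠ x in 𝓝 (1 : Fin (m + 3) → ℝ), Ψ 1 (Submodule.span ℝ {P.equivFun.symm x}) =
      Submodule.span ℝ {Q.equivFun.symm fun k => x k ^ a} := by
    filter_upwards [ha, hy] with x hx hxy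
    obtain ⟨c, hc, hyx⟩ := hx
    have : y x = c • fun k => x k ^ a := funext hyx
    rw [hxy, this, map_smul, Submodule.span_singleton_smul_eq (IsUnit.mk0 c hc)]
  have hΦ' := (hXP.tendsto' (∑ l, P l) 1
    (by rw [← equivFun_symm_one, LinearEquiv.apply_symm_apply])).eventually hΦ
  rcases hΨ.exponent_eq_zero_or_one hO hmem hΦ with rfl | rfl
  · refine Or.inl ?_
    filter_upwards [hΦ'] with p hp
    simp only [LinearEquiv.symm_apply_apply, Real.rpow_zero] at hp
    rw [hp, ← equivFun_symm_one (P := Q)]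
    rfl
  · refine Or.inr ?_
    filter_upwards [hΦ'] with p hp
    simp only [LinearEquiv.symm_apply_apply, Real.rpow_one] at hp
    rw [hp]
    congr 2
    rw [Q.equivFun_symm_apply]
    conv_rhs => rw [← P.sum_equivFun p, map_sum]
    refine Finset.sum_congr rfl fun k _ => ?_
    rw [map_smul, Module.Basis.equiv_apply, Equiv.refl_apply]

end LocalRigidity

end FlagRigidity

namespace FlagRigidity

/-! ### Unipotent matrices and the big cell -/

section Unipotent

open Matrix

variable {n : ℕ}

/-- The columns of a matrix, from the last to the first. -/
def colFrame (A : Matrix (Fin n) (Fin n) ℝ) : Fin n → Fin n → ℝ := fun k a => A a (Fin.rev k)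

theorem colFrame_eq_mulVec (A : Matrix (Fin n) (Fin n) ℝ) (k : Fin n) :
    colFrame A k = A *ᵥ colFrame 1 k := by
  have : colFrame (1 : Matrix (Fin n) (Fin n) ℝ) k = Pi.single (Fin.rev k) 1 := by
    funext a
    simp [colFrame, Matrix.one_apply, Pi.single_apply]
  rw [this, Matrix.mulVec_single_one]
  rfl

theorem linearIndependent_colFrame (g : GL (Fin n) ℝ) :
    LinearIndependent ℝ (colFrame (g : Matrix (Fin n) (Fin n) ℝ)) := by
  have h : LinearIndependent ℝ (g : Matrix (Fin n) (Fin n) ℝ).col := by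
    rw [← Matrix.mulVec_injective_iff]
    exact Matrix.mulVec_injective_of_isUnit g.isUnit
  exact h.comp _ Fin.rev_injective

theorem spanLT_colFrame_one (d : ℕ) : spanLT (colFrame (1 : Matrix (Fin n) (Fin n) ℝ)) d =
    lowerSpace n d := by
  rw [spanLT, lowerSpace]
  congr 1
  have h : ∀ k, colFrame (1 : Matrix (Fin n) (Fin n) ℝ) k = Pi.single (Fin.rev k) 1 := by
    intro k
    funext a
    simp [colFrame, Matrix.one_apply, Pi.single_apply]
  ext x
  constructor
  · rintro ⟨k, hk, rfl⟩
    refine ⟨Fin.rev k, ?_, (h k).symm⟩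
    change n ≤ (Fin.rev k : ℕ) + d
    change (k : ℕ) < d at hk
    rw [Fin.val_rev]
    omega
  · rintro ⟨k, hk, rfl⟩
    refine ⟨Fin.rev k, ?_, by rw [h, Fin.rev_rev]⟩
    change n ≤ (k : ℕ) + d at hk
    change (Fin.rev k : ℕ) < d
    rw [Fin.val_rev]
    omega

/-- The basis of the columns of an invertible matrix, from the last to the first. -/
def toFrame (g : GL (Fin n) ℝ) : {v : Fin n → Fin n → ℝ // LinearIndependent ℝ v} :=
  ⟨colFrame g.val, linearIndependent_colFrame g⟩

theorem baseFlag_eq_frameFlag : baseFlag n = frameFlag (toFrame 1) := by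
  refine Subtype.ext (funext fun j => Subtype.ext ?_)
  change lowerSpace n (j + 1) = spanLT (colFrame (1 : Matrix (Fin n) (Fin n) ℝ)) (j + 1)
  rw [spanLT_colFrame_one]

theorem orbitMap_eq_frameFlag (y : unipotent n) : orbitMap y = frameFlag (toFrame y.1) := by
  rw [orbitMap, baseFlag_eq_frameFlag, smul_frameFlag]
  congr 1
  refine Subtype.ext (funext fun k => ?_)
  exact (colFrame_eq_mulVec _ k).symm

theorem orbitMap_one : orbitMap (1 : unipotent n) = baseFlag n :=
  one_smul (GL (Fin n) ℝ) _

theorem mem_lowerSpace_iff {d : ℕ} {x : Fin n → ℝ} :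
    x ∈ lowerSpace n d ↔ ∀ a : Fin n, (a : ℕ) + d < n → x a = 0 := by
  constructor
  · intro hx
    induction hx using Submodule.span_induction with
    | mem x hx =>
      obtain ⟨i, hi, rfl⟩ := hx
      intro a ha
      refine Pi.single_eq_of_ne ?_ _
      rintro rfl
      exact absurd hi (not_le.2 ha)
    | zero => intro a _; rfl
    | add x y _ _ hx hy => intro a ha; simp [hx a ha, hy a ha]
    | smul c x _ hx => intro a ha; simp [hx a ha]
  · intro h
    have hx : x = ∑ a, x a • (Pi.single a 1 : Fin n → ℝ) := by
      funext b
      simp [Finset.sum_apply, Pi.single_apply]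
    rw [hx]
    refine Submodule.sum_mem _ fun a _ => ?_
    by_cases ha : (a : ℕ) + d < n
    · rw [h a ha, zero_smul]
      exact Submodule.zero_mem _
    · exact Submodule.smul_mem _ _ (Submodule.subset_span ⟨a, not_lt.1 ha, rfl⟩)

/-- The unipotent matrices that fix the `d`-dimensional member of the base flag. -/
def FixesLower (d : ℕ) (y : unipotent n) : Prop :=
  ∀ a b : Fin n, (a : ℕ) + d < n → n ≤ (b : ℕ) + d → (y : GL (Fin n) ℝ) a b = 0

theorem fixesLower_iff (j : Fin (n - 1)) (y : unipotent n) :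
    FixesLower (j + 1) y ↔ proj j (orbitMap y) = proj j (baseFlag n) := by
  rw [orbitMap_eq_frameFlag]
  have hj : (j : ℕ) + 1 ≤ n := by omega
  have h1 : (proj j (frameFlag (toFrame y.1))).1 = spanLT (toFrame y.1).1 (j + 1) := rfl
  have h2 : (proj j (baseFlag n)).1 = lowerSpace n (j + 1) := rfl
  constructor
  · intro h
    refine Subtype.ext ?_
    rw [h1, h2]
    refine Submodule.eq_of_le_of_finrank_eq ((spanLT_le_iff _ _ _).2 fun k hk => ?_) ?_
    · rw [mem_lowerSpace_iff]
      intro a ha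
      refine h a (Fin.rev k) ha ?_
      rw [Fin.val_rev]
      omega
    · rw [finrank_lowerSpace hj, finrank_spanLT (toFrame y.1).2 hj]
  · intro h a b ha hb
    have h3 := congrArg Subtype.val h
    rw [h1, h2] at h3
    have h4 := mem_spanLT (toFrame y.1).1 (m := Fin.rev b) (d := j + 1)
      (by rw [Fin.val_rev]; omega)
    rw [h3, mem_lowerSpace_iff] at h4
    have := h4 a ha
    simpa [toFrame, colFrame] using this

/-- The element of `N` with given matrix. -/
noncomputable def unipotentOf (A : Matrix (Fin n) (Fin n) ℝ) (h0 : ∀ i j, j < i → A i j = 0)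
    (h1 : ∀ i, A i i = 1) : unipotent n :=
  ⟨Matrix.GeneralLinearGroup.mkOfDetNeZero A (by
    rw [Matrix.det_of_isUpperTriangular fun i j h => h0 i j h]
    simp [h1]), h0, h1⟩

theorem unipotentOf_apply (A : Matrix (Fin n) (Fin n) ℝ) (h0 : ∀ i j, j < i → A i j = 0)
    (h1 : ∀ i, A i i = 1) (i j : Fin n) : (unipotentOf A h0 h1 : GL (Fin n) ℝ) i j = A i j :=
  rfl

/-- The elementary unipotent matrix with entry `1` at the position `(i, j)`. -/
noncomputable def elementary {i j : Fin n} (h : i < j) : unipotent n :=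
  unipotentOf (Matrix.transvection i j 1)
    (fun a b hab => by
      rw [Matrix.transvection, Matrix.add_apply, Matrix.one_apply_ne hab.ne',
        Matrix.single_apply_of_ne (h := by grind), add_zero])
    (fun a => by
      rw [Matrix.transvection, Matrix.add_apply, Matrix.one_apply_eq,
        Matrix.single_apply_of_ne (h := by grind), add_zero])

theorem elementary_apply {i j : Fin n} (h : i < j) (a b : Fin n) :
    (elementary h : GL (Fin n) ℝ) a b = if a = b then 1 else if a = i ∧ b = j then 1 else 0 := by
  rw [elementary, unipotentOf_apply, Matrix.transvection, Matrix.add_apply, Matrix.one_apply,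
    Matrix.single_apply]
  grind

theorem unipotent_ext {y z : unipotent n}
    (h : ∀ a b, a < b → (y : GL (Fin n) ℝ) a b = (z : GL (Fin n) ℝ) a b) : y = z := by
  refine Subtype.ext (Matrix.GeneralLinearGroup.ext fun a b => ?_)
  rcases lt_trichotomy a b with hab | rfl | hab
  · exact h a b hab
  · rw [y.2.2, z.2.2]
  · rw [y.2.1 a b hab, z.2.1 a b hab]

/-- A matrix whose only nonzero off-diagonal entry is at `(i, j)` adds a multiple of the `j`-th
row to the `i`-th row. -/
theorem mul_apply_of_offDiag {i j : Fin n} (hij : i < j) {x : unipotent n}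
    (hx : ∀ a b, a < b → ¬ (a = i ∧ b = j) → (x : GL (Fin n) ℝ) a b = 0) (y : unipotent n)
    (a b : Fin n) : ((x * y : unipotent n) : GL (Fin n) ℝ) a b = (y : GL (Fin n) ℝ) a b +
      if a = i then (x : GL (Fin n) ℝ) i j * (y : GL (Fin n) ℝ) j b else 0 := by
  have h0 : ((x * y : unipotent n) : GL (Fin n) ℝ) a b =
      ∑ k, (x : GL (Fin n) ℝ) a k * (y : GL (Fin n) ℝ) k b := by
    rw [Subgroup.coe_mul, Matrix.GeneralLinearGroup.coe_mul, Matrix.mul_apply]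
  have hz : ∀ k, k ≠ a → ¬ (a = i ∧ k = j) → (x : GL (Fin n) ℝ) a k = 0 := by
    intro k hk hne
    rcases lt_or_gt_of_ne hk with h | h
    · exact x.2.1 a k h
    · exact hx a k h hne
  rw [h0, ← Finset.add_sum_erase _ _ (Finset.mem_univ a), x.2.2, one_mul]
  congr 1
  split_ifs with ha
  · subst ha
    rw [Finset.sum_eq_single_of_mem j (by simp [hij.ne'])]
    intro k hk hkj
    rw [hz k (Finset.ne_of_mem_erase hk) (by tauto), zero_mul]
  · refine Finset.sum_eq_zero fun k hk => ?_
    rw [hz k (Finset.ne_of_mem_erase hk) (by tauto), zero_mul]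

theorem frameFlag_smul (v : {v : Fin n → Fin n → ℝ // LinearIndependent ℝ v}) {c : Fin n → ℝ}
    (h : LinearIndependent ℝ fun k => c k • v.1 k) :
    frameFlag ⟨fun k => c k • v.1 k, h⟩ = frameFlag v :=
  flag_eq_frameFlag fun _ _ hm => Submodule.smul_mem _ _ (mem_spanLT _ (Nat.lt_succ_of_le hm))

theorem linearIndependent_smul {v : Fin n → Fin n → ℝ} (hv : LinearIndependent ℝ v) {c : Fin n → ℝ}
    (hc : ∀ k, c k ≠ 0) : LinearIndependent ℝ fun k => c k • v k := by
  have := hv.units_smul fun k => Units.mk0 (c k) (hc k)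
  exact this

theorem smul_mem_frameSet {V : Set (FlagManifold n)} {v : Fin n → Fin n → ℝ}
    (hv : v ∈ frameSet V) {c : Fin n → ℝ} (hc : ∀ k, c k ≠ 0) :
    (fun k => c k • v k) ∈ frameSet V := by
  obtain ⟨hli, hV⟩ := hv
  refine ⟨linearIndependent_smul hli hc, ?_⟩
  rwa [frameFlag_smul ⟨v, hli⟩]

/-- A flag in general position to the flag spanned by the first basis vectors lies in the big
cell. -/
theorem exists_orbitMap_eq (v : {v : Fin n → Fin n → ℝ // LinearIndependent ℝ v})
    (h : ∀ d ≤ n, ∀ x ∈ spanLT v.1 d, (∀ a : Fin n, n ≤ (a : ℕ) + d → x a = 0) → x = 0) :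
    ∃ y : unipotent n, orbitMap y = frameFlag v := by
  have hcol : ∀ b : Fin n, ∃ x ∈ spanLT v.1 (n - b), x b = 1 ∧ ∀ a, b < a → x a = 0 := by
    intro b
    -- Restriction to the last `n - b` coordinates is injective by general position, hence bijective
    -- by dimension. The preimage of the first unit vector is column `b` of the desired matrix.
    let π : spanLT v.1 (n - b) →ₗ[ℝ] ({a : Fin n // b ≤ a} → ℝ) :=
      (LinearMap.funLeft ℝ ℝ Subtype.val).comp (spanLT v.1 (n - b)).subtype
    have hinj : Function.Injective π := by
      rw [← LinearMap.ker_eq_bot, LinearMap.ker_eq_bot']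
      intro x hx
      refine Subtype.ext (h (n - b) (by omega) x x.2 fun a ha => ?_)
      have hba : b ≤ a := by rw [Fin.le_def]; omega
      exact congrFun hx ⟨a, hba⟩
    have hcard : Fintype.card {a : Fin n // b ≤ a} = n - b := by
      rw [Fintype.card_subtype]
      have : (Finset.univ.filter fun a => b ≤ a) = Finset.Ici b := by ext; simp
      rw [this, Fin.card_Ici]
    have hsurj : Function.Surjective π := by
      refine (LinearMap.injective_iff_surjective_of_finrank_eq_finrank ?_).1 hinj
      rw [finrank_spanLT v.2 (by omega), Module.finrank_fintype_fun_eq_card, hcard]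
    obtain ⟨x, hx⟩ := hsurj (Pi.single ⟨b, le_rfl⟩ 1)
    refine ⟨x, x.2, ?_, fun a ha => ?_⟩
    · have := congrFun hx ⟨b, le_rfl⟩
      rwa [Pi.single_eq_same] at this
    · have := congrFun hx ⟨a, ha.le⟩
      rwa [Pi.single_eq_of_ne (by simpa using ha.ne')] at this
  choose x hx hx1 hx0 using hcol
  refine ⟨unipotentOf (fun a b => x b a) (fun i j hij => hx0 j i hij) hx1, ?_⟩
  rw [orbitMap_eq_frameFlag]
  refine flag_eq_frameFlag fun j k hk => ?_
  change x (Fin.rev k) ∈ spanLT v.1 (j + 1)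
  refine spanLT_mono v.1 ?_ (hx (Fin.rev k))
  rw [Fin.val_rev]
  omega

/-! ### The moment curve -/

/-- The moment curve `s ↦ (s^(n-1), …, s, 1)`. -/
def moment (n : ℕ) (s : ℝ) : Fin n → ℝ := fun a => s ^ (n - 1 - (a : ℕ))

/-- The last `d` coordinates of a moment vector are the powers of exponent below `d`, so this is the
invertibility of a Vandermonde matrix. -/
theorem eq_zero_of_sum_moment {d : ℕ} (hd : d ≤ n) {t : Fin d → ℝ} (ht : Function.Injective t)
    {c : Fin d → ℝ} (h : ∀ a : Fin n, n ≤ (a : ℕ) + d → ∑ k, c k * moment n (t k) a = 0) :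
    c = 0 := by
  refine Matrix.eq_zero_of_forall_pow_sum_mul_pow_eq_zero ht fun s => ?_
  have := h ⟨n - 1 - s, by omega⟩ (by simp only; omega)
  simp only [moment] at this
  rwa [show n - 1 - (n - 1 - (s : ℕ)) = s by omega] at this

theorem linearIndependent_moment {t : Fin n → ℝ} (ht : Function.Injective t) :
    LinearIndependent ℝ fun k => moment n (t k) := by
  rw [Fintype.linearIndependent_iff]
  intro c hc
  have := eq_zero_of_sum_moment le_rfl ht (c := c) fun a _ => by
    have := congrFun hc a
    simpa [Finset.sum_apply] using this
  exact congrFun this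

theorem exists_orbitMap_eq_moment {t : Fin n → ℝ} (ht : Function.Injective t) :
    ∃ y : unipotent n, orbitMap y = frameFlag ⟨_, linearIndependent_moment ht⟩ := by
  refine exists_orbitMap_eq _ fun d hd x hx h0 => ?_
  rw [spanLT_eq_span_range _ hd, Submodule.mem_span_range_iff_exists_fun] at hx
  obtain ⟨c, rfl⟩ := hx
  have : c = 0 := eq_zero_of_sum_moment hd (t := fun k => t (Fin.castLE hd k))
    (ht.comp (Fin.castLE_injective hd)) fun a ha => by
      have := h0 a ha
      simpa [Finset.sum_apply] using this
  simp [this]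

/-! ### Dilations -/

theorem dilation_apply (r : ℝˣ) (y : unipotent n) (a b : Fin n) :
    (dilation r y : GL (Fin n) ℝ) a b =
      ((r : ℝ) ^ ((a : ℕ) + 1))⁻¹ * (y : GL (Fin n) ℝ) a b * (r : ℝ) ^ ((b : ℕ) + 1) := by
  change (diagPow n r * (y : GL (Fin n) ℝ) * (diagPow n r)⁻¹) a b = _
  rw [diagPow_conj_apply]
  simp

theorem dilation_apply_of_le (r : ℝˣ) (y : unipotent n) {a b : Fin n} (h : a ≤ b) :
    (dilation r y : GL (Fin n) ℝ) a b = (r : ℝ) ^ ((b : ℕ) - a) * (y : GL (Fin n) ℝ) a b := by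
  rw [dilation_apply]
  have h' : (a : ℕ) ≤ b := h
  have : (r : ℝ) ^ ((b : ℕ) + 1) = (r : ℝ) ^ ((a : ℕ) + 1) * (r : ℝ) ^ ((b : ℕ) - a) := by
    rw [← pow_add]
    congr 1
    omega
  rw [this]
  have hr : (r : ℝ) ≠ 0 := r.ne_zero
  field_simp

theorem fixesLower_dilation {d : ℕ} {y : unipotent n} (h : FixesLower d y) (r : ℝˣ) :
    FixesLower d (dilation r y) := by
  intro a b ha hb
  rw [dilation_apply, h a b ha hb]
  ring

theorem diagPow_mulVec (r : ℝˣ) (x : Fin n → ℝ) (a : Fin n) :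
    ((diagPow n r : Matrix (Fin n) (Fin n) ℝ) *ᵥ x) a = ((r : ℝ) ^ ((a : ℕ) + 1))⁻¹ * x a := by
  change ((Matrix.diagonal fun i : Fin n => (((r ^ ((i : ℕ) + 1))⁻¹ : ℝˣ) : ℝ)) *ᵥ x) a = _
  rw [Matrix.mulVec_diagonal]
  simp

theorem diagPow_smul_baseFlag (r : ℝˣ) : diagPow n r • baseFlag n = baseFlag n := by
  have hb : ∀ j : Fin (n - 1), ((baseFlag n).1 j).1 = lowerSpace n (j + 1) := fun j => rfl
  refine Subtype.ext (funext fun j => Subtype.ext ?_)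
  change mapSubspace (diagPow n r) (lowerSpace n (j + 1)) = lowerSpace n (j + 1)
  refine Submodule.eq_of_le_of_finrank_eq ?_ (finrank_mapSubspace _ _)
  rintro _ ⟨x, hx, rfl⟩
  have hx' := mem_lowerSpace_iff.1 hx
  refine mem_lowerSpace_iff.2 fun a ha => ?_
  rw [Matrix.mulVecLin_apply, diagPow_mulVec, hx' a ha, mul_zero]

theorem orbitMap_dilation (r : ℝˣ) (y : unipotent n) :
    orbitMap (dilation r y) = diagPow n r • orbitMap y := by
  have h : (diagPow n r)⁻¹ • baseFlag n = baseFlag n := by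
    rw [inv_smul_eq_iff, diagPow_smul_baseFlag]
  rw [orbitMap, orbitMap]
  change (diagPow n r * (y : GL (Fin n) ℝ) * (diagPow n r)⁻¹) • baseFlag n = _
  rw [mul_smul, mul_smul, h]

theorem moment_mul (r : ℝˣ) (s : ℝ) : moment n (r * s) =
    (r : ℝ) ^ n • ((diagPow n r : Matrix (Fin n) (Fin n) ℝ) *ᵥ moment n s) := by
  funext a
  rw [Pi.smul_apply, diagPow_mulVec, moment, moment, smul_eq_mul, mul_pow, ← mul_assoc]
  congr 1
  have hr : (r : ℝ) ≠ 0 := r.ne_zero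
  rw [eq_mul_inv_iff_mul_eq₀ (pow_ne_zero _ hr), ← pow_add]
  congr 1
  omega

/-- Scaling the parameters of the moment curve by `r` is the action of `diagPow n r` up to scalar
factors, and on the chart this action is the dilation. -/
theorem frameFlag_moment_mul (r : ℝˣ) {t : Fin n → ℝ} (ht : Function.Injective t)
    (ht' : LinearIndependent ℝ fun k => moment n (r * t k)) {y : unipotent n}
    (hy : orbitMap y = frameFlag ⟨_, linearIndependent_moment ht⟩) :
    frameFlag ⟨fun k => moment n (r * t k), ht'⟩ = orbitMap (dilation r y) := by
  rw [orbitMap_dilation, hy, smul_frameFlag]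
  refine flag_eq_frameFlag fun j k hk => ?_
  change moment n (r * t k) ∈ _
  rw [moment_mul]
  exact Submodule.smul_mem _ _ (mem_spanLT _ (Nat.lt_succ_of_le hk))

end Unipotent

end FlagRigidity

namespace FlagRigidity

/-! ### General position -/

theorem linearIndependent_mul_left {n : ℕ} {v : Fin n → Fin n → ℝ} (hv : LinearIndependent ℝ v)
    {c : Fin n → ℝ} (hc : ∀ a, c a ≠ 0) : LinearIndependent ℝ fun k a => c a * v k a := by
  rw [Fintype.linearIndependent_iff] at hv ⊢
  intro g hg
  refine hv g (funext fun a => ?_)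
  have h1 := congrFun hg a
  simp only [Finset.sum_apply, Pi.smul_apply, smul_eq_mul, Pi.zero_apply] at h1 ⊢
  have h2 : c a * ∑ k, g k * v k a = 0 := by
    rw [← h1, Finset.mul_sum]
    exact Finset.sum_congr rfl fun k _ => by ring
  exact (mul_eq_zero.1 h2).resolve_left (hc a)

/-- A basis adapted to `n + 1` vectors in general position in `ℝⁿ`. -/
theorem exists_basis_of_general_position {n : ℕ} (z : Option (Fin n) → Fin n → ℝ)
    (h : ∀ σ : Fin n → Option (Fin n), Function.Injective σ →
      LinearIndependent ℝ fun k => z (σ k)) :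
    ∃ (Q : Module.Basis (Fin n) ℝ (Fin n → ℝ)) (c : Fin n → ℝ), (∀ k, c k ≠ 0) ∧
      (∀ k, Q k = c k • z (some k)) ∧ ∑ k, Q k = z none := by
  have hli := h some (Option.some_injective _)
  let b := basisOfLinearIndependentOfCardEqFinrank' _ hli (by simp)
  have hb : ∀ k, b k = z (some k) := fun k => by
    simp [b]
  obtain ⟨x, hsum⟩ : ∃ x : Fin n → ℝ, ∑ k, x k • z (some k) = z none := by
    refine ⟨b.equivFun (z none), ?_⟩
    conv_rhs => rw [← b.sum_equivFun (z none)]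
    exact Finset.sum_congr rfl fun k _ => by rw [hb]
  -- If `x k = 0`, then `z none` is a combination of the other vectors, against the independence of
  -- the tuple with `z (some k)` replaced by `z none`.
  have hne : ∀ k, x k ≠ 0 := by
    intro k hk
    have hσ : Function.Injective (Function.update (fun l : Fin n => some l) k none) := by
      intro i j hij
      by_cases hi : i = k <;> by_cases hj : j = k
      · rw [hi, hj]
      · subst hi
        rw [Function.update_self, Function.update_of_ne hj] at hij
        exact absurd hij (by simp)
      · subst hj
        rw [Function.update_self, Function.update_of_ne hi] at hij
        exact absurd hij (by simp)
      · rw [Function.update_of_ne hi, Function.update_of_ne hj] at hij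
        exact Option.some.inj hij
    have h1 := Fintype.linearIndependent_iff.1 (h _ hσ)
      (Function.update x k (-1)) ?_ k
    · rw [Function.update_self] at h1
      norm_num at h1
    · rw [← Finset.add_sum_erase _ _ (Finset.mem_univ k)] at hsum ⊢
      rw [hk, zero_smul, zero_add] at hsum
      rw [Function.update_self, Function.update_self, neg_one_smul, ← hsum, neg_add_eq_zero]
      refine Finset.sum_congr rfl fun l hl => ?_
      rw [Function.update_of_ne (Finset.ne_of_mem_erase hl),
        Function.update_of_ne (Finset.ne_of_mem_erase hl)]
  refine ⟨b.isUnitSMul (w := x) fun k => IsUnit.mk0 _ (hne k),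
    x, hne, fun k => ?_, ?_⟩
  · rw [Module.Basis.isUnitSMul_apply, hb]
  · refine Eq.trans ?_ hsum
    exact Finset.sum_congr rfl fun k _ => by rw [Module.Basis.isUnitSMul_apply, hb]

/-! ### From lines to flags -/

section Lines

variable {m : ℕ}

theorem eventually_fixed_of_lines {f : FlagManifold (m + 3) → FlagManifold (m + 3)}
    {V : Set (FlagManifold (m + 3))} (hVo : IsOpen V) (hfib : FibrationPreservingOn f V)
    {v : {v : Fin (m + 3) → Fin (m + 3) → ℝ // LinearIndependent ℝ v}} (hv : frameFlag v ∈ V)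
    (h : ∀ᶠ v' in 𝓝 v.1, ∀ hv' : LinearIndependent ℝ v',
      ((f (frameFlag ⟨v', hv'⟩)).1 ⟨0, by omega⟩).1 = Submodule.span ℝ {v' 0}) :
    ∀ᶠ x in 𝓝 (frameFlag v), f x = x := by
  obtain ⟨Ψ, hΨ, hΨf⟩ := exists_incidenceMap hfib
  have hO := isOpen_frameSet hVo
  have hgood : ∀ᶠ v' in 𝓝 v.1, v' ∈ frameSet V ∧
      ∀ᶠ p in 𝓝 (v' 0), Ψ 1 (Submodule.span ℝ {p}) = Submodule.span ℝ {p} := by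
    have hmem : ∀ᶠ v' in 𝓝 v.1, v' ∈ frameSet V := hO.mem_nhds ⟨v.2, hv⟩
    filter_upwards [hmem, (hmem.and h).eventually_nhds] with v' h1 h2
    refine ⟨h1, ?_⟩
    have hc : Continuous fun p : Fin (m + 3) → ℝ => Function.update v' 0 p :=
      continuous_const.update 0 continuous_id
    filter_upwards [(hc.tendsto' (v' 0) v' (by simp)).eventually h2] with p hp
    obtain ⟨⟨hli, hpV⟩, hp2⟩ := hp
    have h3 := hp2 hli
    rw [hΨf ⟨_, hli⟩ hpV ⟨0, by omega⟩] at h3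
    simp only [zero_add, spanLT_one, Function.update_self] at h3
    exact h3
  have hB : frameFlag '' (Subtype.val ⁻¹' {v' | v' ∈ frameSet V ∧
      ∀ᶠ p in 𝓝 (v' 0), Ψ 1 (Submodule.span ℝ {p}) = Submodule.span ℝ {p}}) ∈
      𝓝 (frameFlag v) :=
    isOpenMap_frameFlag.image_mem_nhds (continuous_subtype_val.continuousAt hgood)
  filter_upwards [hB]
  rintro _ ⟨w, ⟨hwV, hw⟩, rfl⟩
  refine Subtype.ext (funext fun j => Subtype.ext ?_)
  rw [hΨf w hwV.2 j]
  exact hΨ.fixes_spanLT hO hwV hw (by omega) (by omega)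

open Classical in
/-- The flag of a tuple, if it is a basis. -/
noncomputable def flagOf {n : ℕ} (v : Fin n → Fin n → ℝ) : FlagManifold n :=
  if h : LinearIndependent ℝ v then frameFlag ⟨v, h⟩ else baseFlag n

theorem flagOf_eq {n : ℕ} {v : Fin n → Fin n → ℝ} (h : LinearIndependent ℝ v) :
    flagOf v = frameFlag ⟨v, h⟩ := dif_pos h

theorem continuousOn_flagOf {n : ℕ} :
    ContinuousOn (flagOf (n := n)) {v | LinearIndependent ℝ v} := by
  rw [continuousOn_iff_continuous_domRestrict]
  exact continuous_frameFlag.congr fun v => (flagOf_eq v.2).symm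

/-- Project the fixed vector `u₀` orthogonally to the image lines. The result is continuous at `v
0`, where it equals `u₀ ≠ 0`, so it spans the image line nearby. -/
theorem exists_continuous_lift {f : FlagManifold (m + 3) → FlagManifold (m + 3)}
    {V : Set (FlagManifold (m + 3))} (hVo : IsOpen V) (hf : ContinuousOn f V)
    {Ψ : ℕ → Submodule ℝ (Fin (m + 3) → ℝ) → Submodule ℝ (Fin (m + 3) → ℝ)}
    (hΨf : ∀ v : {v : Fin (m + 3) → Fin (m + 3) → ℝ // LinearIndependent ℝ v}, frameFlag v ∈ V →
      ∀ j : Fin (m + 3 - 1), ((f (frameFlag v)).1 j).1 = Ψ (j + 1) (spanLT v.1 (j + 1)))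
    {v : Fin (m + 3) → Fin (m + 3) → ℝ} (hv : v ∈ frameSet V) {u₀ : Fin (m + 3) → ℝ}
    (h : Ψ 1 (Submodule.span ℝ {v 0}) = Submodule.span ℝ {u₀}) :
    ∃ u : (Fin (m + 3) → ℝ) → Fin (m + 3) → ℝ, ContinuousAt u (v 0) ∧ u (v 0) = u₀ ∧
      ∀ᶠ p in 𝓝 (v 0), Ψ 1 (Submodule.span ℝ {p}) = Submodule.span ℝ {u p} := by
  have hO := isOpen_frameSet hVo
  have hc : Continuous fun p : Fin (m + 3) → ℝ => Function.update v 0 p :=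
    continuous_const.update 0 continuous_id
  have hΨ0 : ∀ (v' : Fin (m + 3) → Fin (m + 3) → ℝ), v' ∈ frameSet V →
      ((f (flagOf v')).1 ⟨0, by omega⟩).1 = Ψ 1 (Submodule.span ℝ {v' 0}) := by
    rintro v' ⟨hli, hV⟩
    rw [flagOf_eq hli, hΨf ⟨v', hli⟩ hV ⟨0, by omega⟩]
    simp only [zero_add, spanLT_one]
  let u : (Fin (m + 3) → ℝ) → Fin (m + 3) → ℝ := fun p =>
    (projectionMatrix ((f (flagOf (Function.update v 0 p))).1 ⟨0, by omega⟩)).mulVec u₀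
  have hup : Function.update v 0 (v 0) = v := by simp
  have hu0 : u (v 0) = u₀ := by
    refine projectionMatrix_mulVec_of_mem _ ?_
    rw [hup, hΨ0 v hv, h]
    exact Submodule.mem_span_singleton_self _
  have hne : u₀ ≠ 0 := by
    rintro rfl
    have h1 := ((f (flagOf v)).1 ⟨0, by omega⟩).2
    rw [hΨ0 v hv, h, Submodule.span_zero_singleton, finrank_bot] at h1
    exact absurd h1 (by omega)
  have huc : ContinuousAt u (v 0) := by
    have h1 : ContinuousAt (fun p => flagOf (Function.update v 0 p)) (v 0) := by
      refine ContinuousAt.comp (g := flagOf) ?_ hc.continuousAt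
      rw [hup]
      exact continuousOn_flagOf.continuousAt (isOpen_linearIndependent.mem_nhds hv.1)
    have h2 : ContinuousAt (fun p => f (flagOf (Function.update v 0 p))) (v 0) := by
      refine ContinuousAt.comp (g := f) ?_ h1
      rw [hup]
      refine hf.continuousAt (hVo.mem_nhds ?_)
      rw [flagOf_eq hv.1]
      exact hv.2
    have h3 : ContinuousAt (fun p => projectionMatrix
        (proj ⟨0, by omega⟩ (f (flagOf (Function.update v 0 p))))) (v 0) :=
      (continuous_projectionMatrix.comp (continuous_proj _)).continuousAt.comp h2
    have h4 : Continuous fun A : Matrix (Fin (m + 3)) (Fin (m + 3)) ℝ => A.mulVec u₀ :=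
      continuous_id.matrix_mulVec continuous_const
    exact h4.continuousAt.comp h3
  refine ⟨u, huc, hu0, ?_⟩
  filter_upwards [hc.tendsto' (v 0) v hup (hO.mem_nhds hv),
    huc.eventually_ne (by rw [hu0]; exact hne)] with p h1 h2
  have h3 := hΨ0 (Function.update v 0 p) h1
  rw [Function.update_self] at h3
  rw [← h3]
  symm
  refine Submodule.eq_of_le_of_finrank_eq ?_ ?_
  · rw [Submodule.span_singleton_le_iff_mem]
    exact projectionMatrix_mulVec_mem _ _
  · rw [finrank_span_singleton h2, ((f _).1 _).2]

end Lines

/-! ### Blow-up at the base flag -/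

/-- The unit of `ℝ` given by a nonzero real number. -/
noncomputable def posUnit (s : ℝ) : ℝˣ := if h : s ≠ 0 then Units.mk0 s h else 1

theorem coe_posUnit {s : ℝ} (hs : 0 < s) : (posUnit s : ℝ) = s := by
  rw [posUnit, dif_pos hs.ne', Units.val_mk0]

theorem tendsto_posUnit : Tendsto posUnit (𝓝[>] 0) (comap ((↑) : ℝˣ → ℝ) (𝓝[>] 0)) := by
  rw [tendsto_comap_iff]
  refine tendsto_id.congr' ?_
  filter_upwards [self_mem_nhdsWithin] with s hs
  exact (coe_posUnit hs).symm

/-- `f` is a continuous fibration-preserving map near the base flag, given by `h` in the chart at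
the base flag, and the rescalings of `h` converge to `D`. -/
structure BlowUp {n : ℕ} (f : FlagManifold n → FlagManifold n) (V : Set (FlagManifold n))
    (h : unipotent n → unipotent n) (D : unipotent n →* unipotent n) : Prop where
  isOpen : IsOpen V
  base_mem : baseFlag n ∈ V
  continuousOn : ContinuousOn f V
  fibration : FibrationPreservingOn f V
  apply_orbitMap : ∀ y, orbitMap y ∈ V → f (orbitMap y) = orbitMap (h y)
  map_one : h 1 = 1
  tendsto : ∀ y a b, Tendsto
    (fun s : ℝ => (dilation (posUnit s)⁻¹ (h (dilation (posUnit s) y)) : GL (Fin n) ℝ) a b)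
    (𝓝[>] 0) (𝓝 ((D y : GL (Fin n) ℝ) a b))

namespace BlowUp

section

variable {n : ℕ} {f : FlagManifold n → FlagManifold n} {V : Set (FlagManifold n)}
  {h : unipotent n → unipotent n} {D : unipotent n →* unipotent n}

/-- The entry at `(a, b)` is multiplied by `s ^ (b - a)`, so dilations contract every point of the
chart to the base flag. -/
theorem eventually_orbitMap_mem (B : BlowUp f V h D) (y : unipotent n) :
    ∀ᶠ s in 𝓝[>] (0 : ℝ), orbitMap (dilation (posUnit s) y) ∈ V := by
  have hO := isOpen_frameSet B.isOpen
  have hbase : (toFrame (1 : GL (Fin n) ℝ)).1 ∈ frameSet V := by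
    refine ⟨(toFrame 1).2, ?_⟩
    have := B.base_mem
    rwa [baseFlag_eq_frameFlag] at this
  have hlim : Tendsto (fun s : ℝ => (toFrame (dilation (posUnit s) y).1).1) (𝓝[>] 0)
      (𝓝 (toFrame (1 : GL (Fin n) ℝ)).1) := by
    refine tendsto_pi_nhds.2 fun k => tendsto_pi_nhds.2 fun a => ?_
    change Tendsto (fun s : ℝ => (dilation (posUnit s) y : GL (Fin n) ℝ) a (Fin.rev k)) (𝓝[>] 0)
      (𝓝 ((1 : Matrix (Fin n) (Fin n) ℝ) a (Fin.rev k)))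
    generalize Fin.rev k = b
    rcases lt_trichotomy a b with hab | rfl | hab
    · have h1 : Tendsto (fun s : ℝ => s ^ ((b : ℕ) - a) * (y : GL (Fin n) ℝ) a b) (𝓝[>] 0)
          (𝓝 ((1 : Matrix (Fin n) (Fin n) ℝ) a b)) := by
        rw [Matrix.one_apply_ne hab.ne]
        have hab' : (b : ℕ) - a ≠ 0 := by
          have : (a : ℕ) < b := hab
          omega
        have hc : Continuous fun s : ℝ => s ^ ((b : ℕ) - a) * (y : GL (Fin n) ℝ) a b := by
          fun_prop
        exact (hc.tendsto' 0 0 (by simp [hab'])).mono_left nhdsWithin_le_nhds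
      refine h1.congr' ?_
      filter_upwards [self_mem_nhdsWithin] with s hs
      rw [dilation_apply_of_le _ _ hab.le, coe_posUnit hs]
    · refine tendsto_const_nhds.congr fun s => ?_
      rw [Matrix.one_apply_eq, (dilation (posUnit s) y).2.2]
    · refine tendsto_const_nhds.congr fun s => ?_
      rw [Matrix.one_apply_ne hab.ne', (dilation (posUnit s) y).2.1 a b hab]
  filter_upwards [hlim (hO.mem_nhds hbase)] with s hs
  rw [orbitMap_eq_frameFlag]
  exact hs.2

/-- Dilations preserve the stabilizer of the `d`-dimensional member of the base flag. So does `h`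
near the identity, since `f` fixes the base flag and preserves the fiber through it. The entries
that vanish for all small `s` vanish in the limit. -/
theorem fixesLower (B : BlowUp f V h D) {d : ℕ} (h1 : 1 ≤ d) (h2 : d < n) {y : unipotent n}
    (hy : FixesLower d y) : FixesLower d (D y) := by
  intro a b ha hb
  refine tendsto_nhds_unique (B.tendsto y a b) (tendsto_const_nhds.congr' ?_)
  filter_upwards [B.eventually_orbitMap_mem y] with s hs
  obtain ⟨j, rfl⟩ : ∃ j : Fin (n - 1), (j : ℕ) + 1 = d :=
    ⟨⟨d - 1, by omega⟩, Nat.sub_add_cancel h1⟩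
  have h3 := (fixesLower_iff j _).1 (fixesLower_dilation hy (posUnit s))
  have h4 := fibrationPreservingOn_iff.1 B.fibration j _ hs _ B.base_mem h3
  have h5 : f (baseFlag n) = baseFlag n := by
    have := B.apply_orbitMap 1 (by rw [orbitMap_one]; exact B.base_mem)
    rwa [B.map_one, orbitMap_one] at this
  rw [B.apply_orbitMap _ hs, h5, ← fixesLower_iff] at h4
  exact (fixesLower_dilation h4 (posUnit s)⁻¹ a b ha hb).symm

/-- For any other position `(a, b)` above the diagonal some cut `a < e ≤ b` has `e ≠ j`. The
elementary matrix has no entry in rows before `e` and columns from `e` on, that is, it stabilizes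
the member of dimension `n - e`, and so does its image. -/
theorem elementary_offDiag (B : BlowUp f V h D) {i j : Fin n} (hij : (j : ℕ) = i + 1)
    (a b : Fin n) (hab : a < b) (hne : ¬ (a = i ∧ b = j)) :
    (D (elementary (i := i) (j := j) (by rw [Fin.lt_def]; omega)) : GL (Fin n) ℝ) a b = 0 := by
  have hab' : (a : ℕ) < b := hab
  have hne' : ¬ ((a : ℕ) = i ∧ (b : ℕ) = j) := fun h => hne ⟨Fin.ext h.1, Fin.ext h.2⟩
  obtain ⟨e, he1, he2, he3⟩ : ∃ e : ℕ, (a : ℕ) < e ∧ e ≤ b ∧ e ≠ j := by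
    by_cases h1 : (b : ℕ) = j
    · exact ⟨a + 1, by omega, by omega, by omega⟩
    · exact ⟨b, hab', le_rfl, h1⟩
  refine B.fixesLower (d := n - e) (by omega) (by omega) ?_ a b (by omega) (by omega)
  intro a' b' ha' hb'
  rw [elementary_apply, if_neg, if_neg]
  · rintro ⟨rfl, rfl⟩
    omega
  · rintro rfl
    omega

theorem elementary_ne_zero (B : BlowUp f V h D) (hD : Function.Injective D) {i j : Fin n}
    (hij : (j : ℕ) = i + 1) :
    (D (elementary (i := i) (j := j) (by rw [Fin.lt_def]; omega)) : GL (Fin n) ℝ) i j ≠ 0 := by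
  intro h0
  have hlt : i < j := by rw [Fin.lt_def]; omega
  have h1 : D (elementary hlt) = D 1 := by
    rw [_root_.map_one]
    refine unipotent_ext fun a b hab => ?_
    have h2 : ((1 : unipotent n) : GL (Fin n) ℝ) a b = 0 := by
      rw [Subgroup.coe_one, Matrix.GeneralLinearGroup.coe_one, Matrix.one_apply_ne hab.ne]
    rw [h2]
    by_cases hc : a = i ∧ b = j
    · rw [hc.1, hc.2, h0]
    · exact B.elementary_offDiag hij a b hab hc
  have h2 := congrArg (fun z : unipotent n => (z : GL (Fin n) ℝ) i j) (hD h1)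
  simp only [elementary_apply, hlt.ne, if_false, and_self, if_true, Subgroup.coe_one,
    Matrix.GeneralLinearGroup.coe_one, Matrix.one_apply_ne hlt.ne] at h2
  exact one_ne_zero h2

end

section

variable {m : ℕ} {f : FlagManifold (m + 3) → FlagManifold (m + 3)}
  {V : Set (FlagManifold (m + 3))} {h : unipotent (m + 3) → unipotent (m + 3)}
  {D : unipotent (m + 3) →* unipotent (m + 3)}

/-- The column is filled from the bottom up. Left multiplication by the elementary matrix at `(i, i
+ 1)` adds the entry of row `i + 1` to row `i`, and `D` turns this into the same operation with a
nonzero factor. Row `i` was still zero on both sides, so nothing can cancel. -/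
theorem exists_last_column (B : BlowUp f V h D) (hD : Function.Injective D) :
    ∃ (w : unipotent (m + 3)), (∀ a, (w : GL (Fin (m + 3)) ℝ) a (Fin.last _) = 1) ∧
      ∀ a, (D w : GL (Fin (m + 3)) ℝ) a (Fin.last _) ≠ 0 := by
  have key : ∀ s : ℕ, s ≤ m + 2 → ∃ w : unipotent (m + 3),
      (∀ a : Fin (m + 3), m + 2 ≤ (a : ℕ) + s →
        (w : GL (Fin (m + 3)) ℝ) a (Fin.last _) = 1 ∧
        (D w : GL (Fin (m + 3)) ℝ) a (Fin.last _) ≠ 0) ∧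
      ∀ a : Fin (m + 3), (a : ℕ) + s < m + 2 →
        (w : GL (Fin (m + 3)) ℝ) a (Fin.last _) = 0 ∧
        (D w : GL (Fin (m + 3)) ℝ) a (Fin.last _) = 0 := by
    intro s
    induction s with
    | zero =>
      intro _
      refine ⟨1, fun a ha => ?_, fun a ha => ?_⟩
      · have : a = Fin.last _ := Fin.ext (by rw [Fin.val_last]; omega)
        rw [this, _root_.map_one]
        simp
      · have : a ≠ Fin.last _ := by
          rintro rfl
          rw [Fin.val_last] at ha
          omega
        rw [_root_.map_one]
        simp [this]
    | succ s ih =>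
      intro hs
      obtain ⟨w, hw1, hw0⟩ := ih (by omega)
      let i : Fin (m + 3) := ⟨m + 2 - (s + 1), by omega⟩
      let j : Fin (m + 3) := ⟨m + 2 - s, by omega⟩
      have hij : (j : ℕ) = i + 1 := by simp only [i, j]; omega
      have hlt : i < j := by rw [Fin.lt_def]; omega
      have hj := hw1 j (by simp only [j]; omega)
      have hi := hw0 i (by simp only [i]; omega)
      have hx : ∀ a b, a < b → ¬ (a = i ∧ b = j) →
          (elementary hlt : GL (Fin (m + 3)) ℝ) a b = 0 := by
        intro a b hab hne
        rw [elementary_apply, if_neg hab.ne, if_neg hne]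
      have hxij : (elementary hlt : GL (Fin (m + 3)) ℝ) i j = 1 := by
        rw [elementary_apply, if_neg hlt.ne, if_pos ⟨rfl, rfl⟩]
      have e1 := mul_apply_of_offDiag hlt hx w
      have e2 := mul_apply_of_offDiag (x := D (elementary hlt)) hlt (B.elementary_offDiag hij) (D w)
      refine ⟨elementary hlt * w, fun a ha => ?_, fun a ha => ?_⟩
      · rw [map_mul, e1, e2]
        by_cases hai : a = i
        · subst hai
          rw [if_pos rfl, if_pos rfl, hi.1, hi.2, hj.1, hxij]
          exact ⟨by norm_num, by
            rw [zero_add]; exact mul_ne_zero (B.elementary_ne_zero hD hij) hj.2⟩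
        · have hai' : (a : ℕ) ≠ m + 2 - (s + 1) := fun h => hai (Fin.ext h)
          rw [if_neg hai, if_neg hai, add_zero, add_zero]
          exact hw1 a (by omega)
      · have hai : a ≠ i := by
          rintro rfl
          simp only [i] at ha
          omega
        rw [map_mul, e1, e2, if_neg hai, if_neg hai, add_zero, add_zero]
        exact hw0 a (by omega)
  obtain ⟨w, hw, -⟩ := key (m + 2) le_rfl
  exact ⟨w, fun a => (hw a (by omega)).1, fun a => (hw a (by omega)).2⟩

end

end BlowUp

end FlagRigidity

namespace FlagRigidity

/-! ### Image lines along the moment curve -/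

namespace BlowUp

variable {m : ℕ} {f : FlagManifold (m + 3) → FlagManifold (m + 3)}
  {V : Set (FlagManifold (m + 3))} {h : unipotent (m + 3) → unipotent (m + 3)}
  {D : unipotent (m + 3) →* unipotent (m + 3)}

/-- The last column of the image of `δ_s w`. -/
noncomputable def lastColumn (h : unipotent (m + 3) → unipotent (m + 3)) (w : unipotent (m + 3))
    (s : ℝ) : Fin (m + 3) → ℝ :=
  fun a => (h (dilation (posUnit s) w) : GL (Fin (m + 3)) ℝ) a (Fin.last _)

/-- The last column of `δ_s⁻¹ (h (δ_s w))`. -/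
noncomputable def rescaledColumn (h : unipotent (m + 3) → unipotent (m + 3))
    (w : unipotent (m + 3)) (s : ℝ) : Fin (m + 3) → ℝ :=
  fun a => (dilation (posUnit s)⁻¹ (h (dilation (posUnit s) w)) : GL (Fin (m + 3)) ℝ) a
    (Fin.last _)

theorem lastColumn_eq {w : unipotent (m + 3)} {s : ℝ} (hs : 0 < s) (a : Fin (m + 3)) :
    lastColumn h w s a = s ^ (m + 2 - (a : ℕ)) * rescaledColumn h w s a := by
  rw [rescaledColumn, dilation_apply_of_le _ _ (Fin.le_last a), Units.val_inv_eq_inv_val,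
    coe_posUnit hs, Fin.val_last, lastColumn, inv_pow, ← mul_assoc,
    mul_inv_cancel₀ (pow_ne_zero _ hs.ne'), one_mul]

theorem lastColumn_last (w : unipotent (m + 3)) (s : ℝ) : lastColumn h w s (Fin.last _) = 1 :=
  (h (dilation (posUnit s) w)).2.2 _

theorem tendsto_rescaledColumn (B : BlowUp f V h D) (w : unipotent (m + 3)) (a : Fin (m + 3)) :
    Tendsto (fun s => rescaledColumn h w s a) (𝓝[>] 0)
      (𝓝 ((D w : GL (Fin (m + 3)) ℝ) a (Fin.last _))) :=
  B.tendsto w a _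

theorem toFrame_dilation_zero {w : unipotent (m + 3)}
    (hw : ∀ a, (w : GL (Fin (m + 3)) ℝ) a (Fin.last _) = 1) {s : ℝ} (hs : 0 < s) :
    (toFrame (dilation (posUnit s) w).1).1 0 = moment (m + 3) s := by
  funext a
  change (dilation (posUnit s) w : GL (Fin (m + 3)) ℝ) a (Fin.rev 0) = _
  rw [Fin.rev_zero, dilation_apply_of_le _ _ (Fin.le_last a), coe_posUnit hs, hw, mul_one]
  rfl

theorem line_moment (B : BlowUp f V h D)
    {Ψ : ℕ → Submodule ℝ (Fin (m + 3) → ℝ) → Submodule ℝ (Fin (m + 3) → ℝ)}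
    (hΨf : ∀ v : {v : Fin (m + 3) → Fin (m + 3) → ℝ // LinearIndependent ℝ v}, frameFlag v ∈ V →
      ∀ j : Fin (m + 3 - 1), ((f (frameFlag v)).1 j).1 = Ψ (j + 1) (spanLT v.1 (j + 1)))
    {w : unipotent (m + 3)} (hw : ∀ a, (w : GL (Fin (m + 3)) ℝ) a (Fin.last _) = 1)
    {s : ℝ} (hs : 0 < s) (hV : orbitMap (dilation (posUnit s) w) ∈ V) :
    Ψ 1 (Submodule.span ℝ {moment (m + 3) s}) = Submodule.span ℝ {lastColumn h w s} := by
  have h1 := B.apply_orbitMap _ hV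
  rw [orbitMap_eq_frameFlag] at hV h1
  have h2 := hΨf _ hV ⟨0, by omega⟩
  rw [h1, orbitMap_eq_frameFlag] at h2
  change spanLT (toFrame (h (dilation (posUnit s) w)).1).1 1 = Ψ 1 (spanLT _ 1) at h2
  rw [spanLT_one, spanLT_one, toFrame_dilation_zero hw hs] at h2
  rw [← h2]
  congr 2

theorem tendsto_mul_const_nhdsGT {t : ℝ} (ht : 0 < t) :
    Tendsto (fun r : ℝ => r * t) (𝓝[>] 0) (𝓝[>] 0) := by
  refine tendsto_nhdsWithin_iff.2 ⟨?_, ?_⟩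
  · have hc : Continuous fun r : ℝ => r * t := by fun_prop
    exact (hc.tendsto' 0 0 (by simp)).mono_left nhdsWithin_le_nhds
  · filter_upwards [self_mem_nhdsWithin] with r hr
    exact mul_pos hr ht

/-- Once the factor `r ^ (m + 2 - a)` is removed from coordinate `a`, the columns converge to moment
vectors whose coordinates are multiplied by the nonzero entries of `D w`. These are independent, and
independence is an open condition. -/
theorem eventually_linearIndependent_lastColumn (B : BlowUp f V h D) {w : unipotent (m + 3)}
    (hw : ∀ a, (D w : GL (Fin (m + 3)) ℝ) a (Fin.last _) ≠ 0) {t : Fin (m + 3) → ℝ}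
    (ht : Function.Injective t) (ht0 : ∀ k, 0 < t k) :
    ∀ᶠ r in 𝓝[>] (0 : ℝ), LinearIndependent ℝ fun k => lastColumn h w (r * t k) := by
  have hlim : Tendsto (fun r : ℝ => fun (k : Fin (m + 3)) (a : Fin (m + 3)) =>
      t k ^ (m + 2 - (a : ℕ)) * rescaledColumn h w (r * t k) a) (𝓝[>] 0)
      (𝓝 fun k a => (D w : GL (Fin (m + 3)) ℝ) a (Fin.last _) * moment (m + 3) (t k) a) := by
    refine tendsto_pi_nhds.2 fun k => tendsto_pi_nhds.2 fun a => ?_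
    rw [mul_comm]
    exact ((B.tendsto_rescaledColumn w a).comp (tendsto_mul_const_nhdsGT (ht0 k))).const_mul _
  have hli := linearIndependent_mul_left (linearIndependent_moment ht) hw
  filter_upwards [hlim (isOpen_linearIndependent.mem_nhds hli), self_mem_nhdsWithin] with r hr hr0
  have h1 := linearIndependent_mul_left (c := fun a : Fin (m + 3) => r ^ (m + 2 - (a : ℕ))) hr
    fun a => pow_ne_zero _ (ne_of_gt hr0)
  convert h1 using 3 with k a
  rw [lastColumn_eq (mul_pos hr0 (ht0 k)), mul_pow, mul_assoc]

/-- The flag of moment vectors lies in the big cell, and multiplying the parameters by `r` dilates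
it towards the base flag. -/
theorem eventually_moment_mem (B : BlowUp f V h D) {t : Fin (m + 3) → ℝ}
    (ht : Function.Injective t) :
    ∀ᶠ r in 𝓝[>] (0 : ℝ), (fun k => moment (m + 3) (r * t k)) ∈ frameSet V := by
  obtain ⟨y, hy⟩ := exists_orbitMap_eq_moment ht
  filter_upwards [B.eventually_orbitMap_mem y, self_mem_nhdsWithin] with r hr hr0
  have h1 : Function.Injective fun k => (posUnit r : ℝ) * t k := fun i j hij =>
    ht (mul_left_cancel₀ (posUnit r).ne_zero hij)
  have h2 := frameFlag_moment_mul (posUnit r) ht (linearIndependent_moment h1) hy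
  rw [← h2] at hr
  have h3 : (fun k => moment (m + 3) (posUnit r * t k)) ∈ frameSet V := ⟨_, hr⟩
  rwa [coe_posUnit hr0] at h3

/-- The element of `GL(n, ℝ)` given by a linear automorphism of `ℝⁿ`. -/
noncomputable def toGL {n : ℕ} (g : (Fin n → ℝ) ≃ₗ[ℝ] (Fin n → ℝ)) : GL (Fin n) ℝ where
  val := LinearMap.toMatrix' (g : (Fin n → ℝ) →ₗ[ℝ] (Fin n → ℝ))
  inv := LinearMap.toMatrix' (g.symm : (Fin n → ℝ) →ₗ[ℝ] (Fin n → ℝ))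
  val_inv := by rw [← LinearMap.toMatrix'_comp]; simp
  inv_val := by rw [← LinearMap.toMatrix'_comp]; simp

theorem mapSubspace_toGL {n : ℕ} (g : (Fin n → ℝ) ≃ₗ[ℝ] (Fin n → ℝ)) (p : Fin n → ℝ) :
    mapSubspace (toGL g) (Submodule.span ℝ {p}) = Submodule.span ℝ {g p} := by
  rw [mapSubspace, Submodule.map_span, image_singleton]
  congr 2
  exact LinearMap.toMatrix'_mulVec (g : (Fin n → ℝ) →ₗ[ℝ] (Fin n → ℝ)) p

theorem eventually_eq_smul_of_lines (hVo : IsOpen V) (hfib : FibrationPreservingOn f V)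
    {Ψ : ℕ → Submodule ℝ (Fin (m + 3) → ℝ) → Submodule ℝ (Fin (m + 3) → ℝ)}
    (hΨf : ∀ v : {v : Fin (m + 3) → Fin (m + 3) → ℝ // LinearIndependent ℝ v}, frameFlag v ∈ V →
      ∀ j : Fin (m + 3 - 1), ((f (frameFlag v)).1 j).1 = Ψ (j + 1) (spanLT v.1 (j + 1)))
    {v : {v : Fin (m + 3) → Fin (m + 3) → ℝ // LinearIndependent ℝ v}} (hv : frameFlag v ∈ V)
    (g : (Fin (m + 3) → ℝ) ≃ₗ[ℝ] (Fin (m + 3) → ℝ))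
    (hg : ∀ᶠ p in 𝓝 (v.1 0), Ψ 1 (Submodule.span ℝ {p}) = Submodule.span ℝ {g p}) :
    ∀ᶠ x in 𝓝 (frameFlag v), f x = toGL g • x := by
  have hfib' : FibrationPreservingOn (fun x => (toGL g)⁻¹ • f x) V := by
    simpa using hfib.smul_comp 1 (toGL g)⁻¹
  have hmem : ∀ᶠ v' in 𝓝 v.1, v' ∈ frameSet V := (isOpen_frameSet hVo).mem_nhds ⟨v.2, hv⟩
  have h1 := eventually_fixed_of_lines hVo hfib' hv (by
    filter_upwards [hmem, (continuous_apply 0).continuousAt.eventually hg] with v' h1 h2 hli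
    have h3 := hΨf ⟨v', hli⟩ h1.2 ⟨0, by omega⟩
    simp only [zero_add, spanLT_one] at h3
    rw [h2] at h3
    change mapSubspace (toGL g)⁻¹ ((f (frameFlag ⟨v', hli⟩)).1 ⟨0, by omega⟩).1 = _
    rw [h3, ← mapSubspace_toGL, ← mapSubspace_mul, inv_mul_cancel, mapSubspace_one])
  filter_upwards [h1] with x hx
  exact inv_smul_eq_iff.1 hx

/-- The last coordinate of each column is `1`, so equal lines have equal columns and the column is
constant on an interval `(0, r₀)`. Its entry in row `m + 1` is `s` times a quantity with a finite
limit, so the constant is `0`; then that limit, an entry of `D w`, is `0` as well. -/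
theorem not_locally_const (B : BlowUp f V h D) {w : unipotent (m + 3)}
    (hD : ∀ a, (D w : GL (Fin (m + 3)) ℝ) a (Fin.last _) ≠ 0)
    (hconst : ∀ᶠ r in 𝓝[>] (0 : ℝ), ∀ᶠ s in 𝓝 r,
      Submodule.span ℝ {lastColumn h w s} = Submodule.span ℝ {lastColumn h w r}) : False := by
  obtain ⟨r₀, hr₀, hr⟩ := mem_nhdsGT_iff_exists_Ioo_subset.1 hconst
  rw [mem_Ioi] at hr₀
  let a : Fin (m + 3) := ⟨m + 1, by omega⟩
  have hder : ∀ r ∈ Ioo 0 r₀, HasDerivAt (fun s => lastColumn h w s a) 0 r := by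
    intro r hr'
    refine (hasDerivAt_const r (lastColumn h w r a)).congr_of_eventuallyEq ?_
    filter_upwards [hr hr'] with s hs
    have h1 : lastColumn h w s ∈ Submodule.span ℝ {lastColumn h w r} :=
      hs ▸ Submodule.mem_span_singleton_self _
    obtain ⟨c, hc⟩ := Submodule.mem_span_singleton.1 h1
    have h2 := congrFun hc (Fin.last _)
    rw [Pi.smul_apply, lastColumn_last, lastColumn_last, smul_eq_mul, mul_one] at h2
    rw [← hc, h2, one_smul]
  have hmid : r₀ / 2 ∈ Ioo 0 r₀ := ⟨by positivity, by linarith⟩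
  have heq : ∀ r ∈ Ioo 0 r₀, lastColumn h w r a = lastColumn h w (r₀ / 2) a := fun r hr' =>
    isOpen_Ioo.is_const_of_deriv_eq_zero isPreconnected_Ioo
      (fun s hs => (hder s hs).differentiableAt.differentiableWithinAt)
      (fun s hs => (hder s hs).deriv) hr' hmid
  have hlim := B.tendsto_rescaledColumn w a
  have hid : Tendsto (fun s : ℝ => s) (𝓝[>] 0) (𝓝 0) := tendsto_id.mono_left nhdsWithin_le_nhds
  have hlim0 := hid.mul hlim
  rw [zero_mul] at hlim0
  have hev : ∀ᶠ s in 𝓝[>] (0 : ℝ), s ∈ Ioo 0 r₀ := Ioo_mem_nhdsGT hr₀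
  have hs : ∀ s ∈ Ioo 0 r₀, s * rescaledColumn h w s a = lastColumn h w (r₀ / 2) a := by
    intro s hs
    rw [← heq s hs, lastColumn_eq hs.1]
    have : m + 2 - (a : ℕ) = 1 := by simp only [a]; omega
    rw [this, pow_one]
  have hK : lastColumn h w (r₀ / 2) a = 0 :=
    tendsto_nhds_unique (tendsto_const_nhds.congr' (hev.mono fun s h' => (hs s h').symm)) hlim0
  refine hD a (tendsto_nhds_unique hlim (tendsto_const_nhds.congr' ?_))
  filter_upwards [hev] with s h'
  have h1 := hs s h'
  rw [hK] at h1
  exact ((mul_eq_zero.1 h1).resolve_left h'.1.ne').symm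

theorem exists_projective (B : BlowUp f V h D) (hD : Function.Injective D) :
    ∃ g : GL (Fin (m + 3)) ℝ, ∃ x ∈ V, ∀ᶠ z in 𝓝 x, f z = g • z := by
  obtain ⟨w, hw, hDw⟩ := B.exists_last_column hD
  obtain ⟨Ψ, hΨ, hΨf⟩ := exists_incidenceMap B.fibration
  have hO := isOpen_frameSet B.isOpen
  -- With the projective alternative excluded everywhere, the constant one must hold at every small
  -- `r`, as `not_locally_const` requires.
  by_contra hcon
  -- Any distinct positive parameters would do; the value `1` at `none` makes the unit point of the
  -- frame the moment vector at `r` itself.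
  let t : Option (Fin (m + 3)) → ℝ := fun o => o.elim 1 fun k => (k : ℝ) + 2
  have htnone : t none = 1 := rfl
  have htsome : ∀ k, t (some k) = (k : ℝ) + 2 := fun k => rfl
  have ht0 : ∀ o, 0 < t o := by
    rintro (_ | k)
    · rw [htnone]; exact one_pos
    · rw [htsome]; positivity
  have ht : Function.Injective t := by
    rintro (_ | k) (_ | l) hkl
    · rfl
    · rw [htnone, htsome] at hkl
      have : (0 : ℝ) ≤ (l : ℕ) := Nat.cast_nonneg _
      linarith
    · rw [htnone, htsome] at hkl
      have : (0 : ℝ) ≤ (k : ℕ) := Nat.cast_nonneg _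
      linarith
    · rw [htsome, htsome, add_left_inj, Nat.cast_inj] at hkl
      rw [Fin.ext hkl]
  have e1 : ∀ᶠ r in 𝓝[>] (0 : ℝ), ∀ o, orbitMap (dilation (posUnit (r * t o)) w) ∈ V := by
    rw [eventually_all]
    exact fun o => (tendsto_mul_const_nhdsGT (ht0 o)).eventually (B.eventually_orbitMap_mem w)
  have e2 : ∀ᶠ r in 𝓝[>] (0 : ℝ), ∀ σ : Fin (m + 3) → Option (Fin (m + 3)),
      Function.Injective σ → LinearIndependent ℝ fun k => lastColumn h w (r * t (σ k)) := by
    rw [eventually_all]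
    intro σ
    by_cases hσ : Function.Injective σ
    · filter_upwards [B.eventually_linearIndependent_lastColumn hDw (ht.comp hσ)
        fun k => ht0 (σ k)] with r hr _ using hr
    · exact Eventually.of_forall fun r h => absurd h hσ
  have e3 : ∀ᶠ r in 𝓝[>] (0 : ℝ), ∀ σ : Fin (m + 3) → Option (Fin (m + 3)),
      Function.Injective σ → (fun k => moment (m + 3) (r * t (σ k))) ∈ frameSet V := by
    rw [eventually_all]
    intro σ
    by_cases hσ : Function.Injective σ
    · filter_upwards [B.eventually_moment_mem (ht.comp hσ)] with r hr _ using hr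
    · exact Eventually.of_forall fun r h => absurd h hσ
  have e4 : ∀ᶠ r in 𝓝[>] (0 : ℝ), orbitMap (dilation (posUnit r) w) ∈ V :=
    B.eventually_orbitMap_mem w
  refine B.not_locally_const hDw (w := w) ?_
  filter_upwards [e1, e2, e3, eventually_eventually_nhdsWithin.2 e4, self_mem_nhdsWithin]
    with r h1 h2 h3 h4 hr0
  rw [mem_Ioi] at hr0
  have hline : ∀ o, Ψ 1 (Submodule.span ℝ {moment (m + 3) (r * t o)}) =
      Submodule.span ℝ {lastColumn h w (r * t o)} := fun o =>
    B.line_moment hΨf hw (mul_pos hr0 (ht0 o)) (h1 o)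
  obtain ⟨P, c, hc, hP, hPsum⟩ := exists_basis_of_general_position
    (fun o => moment (m + 3) (r * t o)) fun σ hσ => linearIndependent_moment fun i j hij =>
      (ht.comp hσ) (mul_left_cancel₀ hr0.ne' hij)
  obtain ⟨Q, c', hc', hQ, hQsum⟩ := exists_basis_of_general_position
    (fun o => lastColumn h w (r * t o)) h2
  simp only [htnone, mul_one] at hPsum hQsum
  have hmem : ∀ σ, Function.Injective σ → frameSelect P σ ∈ frameSet V := by
    intro σ hσ
    -- `P` differs from the moment vectors only by nonzero scalars, which do not change flags.
    have h5 : frameSelect P σ = fun k => ((σ k).elim 1 c : ℝ) • moment (m + 3) (r * t (σ k)) := by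
      funext k
      rw [frameSelect]
      rcases σ k with _ | l
      · simp [hPsum, htnone]
      · exact hP l
    rw [h5]
    refine smul_mem_frameSet (h3 σ hσ) fun k => ?_
    rcases σ k with _ | l
    · exact one_ne_zero
    · exact hc l
  have hPQ : ∀ k, Ψ 1 (Submodule.span ℝ {P k}) = Submodule.span ℝ {Q k} := by
    intro k
    rw [hP, hQ, Submodule.span_singleton_smul_eq (IsUnit.mk0 _ (hc k)),
      Submodule.span_singleton_smul_eq (IsUnit.mk0 _ (hc' k)), hline]
  set v := toFrame (dilation (posUnit r) w).1 with hv
  have hv0 : v.1 0 = moment (m + 3) r := toFrame_dilation_zero hw hr0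
  have hvV : frameFlag v ∈ V := by
    have := h1 none
    rwa [htnone, mul_one, orbitMap_eq_frameFlag] at this
  have hline0 : Ψ 1 (Submodule.span ℝ {moment (m + 3) r}) =
      Submodule.span ℝ {lastColumn h w r} := by
    have := hline none
    rwa [htnone, mul_one] at this
  obtain ⟨u, huc, hu, huΨ⟩ := exists_continuous_lift B.isOpen B.continuousOn hΨf
    (v := v.1) ⟨v.2, hvV⟩ (u₀ := lastColumn h w r) (by rw [hv0, hline0])
  rw [hv0, ← hPsum] at huc hu huΨ
  rw [← hQsum] at hu
  rcases hΨ.locally_const_or_projective hO hmem hPQ huc hu huΨ with hc0 | hg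
  · rw [hPsum, hQsum] at hc0
    have hmc : Continuous fun s : ℝ => moment (m + 3) s :=
      continuous_pi fun a => continuous_pow _
    have hIoi : ∀ᶠ s in 𝓝 r, 0 < s := lt_mem_nhds hr0
    have hmemV : ∀ᶠ s in 𝓝 r, orbitMap (dilation (posUnit s) w) ∈ V := by
      rwa [isOpen_Ioi.nhdsWithin_eq hr0] at h4
    filter_upwards [hmc.continuousAt.eventually hc0, hIoi, hmemV] with s h5 h6 h7
    rw [← h5, B.line_moment hΨf hw h6 h7]
  · refine (hcon ⟨toGL (P.equiv Q (Equiv.refl _)), frameFlag v, hvV,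
      eventually_eq_smul_of_lines B.isOpen B.fibration hΨf hvV _ ?_⟩).elim
    rw [hv0, ← hPsum]
    exact hg

end BlowUp

end FlagRigidity
-- Reduction to the base flag and conclusion
namespace FlagRigidity

/-- Translating by `x₀` in the source chart and by `(h x₀)⁻¹` in the target chart moves the point of
differentiability and its image to the base flag. The convergence of the rescalings is applied to
one-point compact sets. -/
theorem exists_blowUp {n : ℕ} {U : Set (FlagManifold n)} {f : FlagManifold n → FlagManifold n}
    (hf : ContinuousOn f U) (hfib : LocallyFibrationPreservingOn f U) {x : FlagManifold n}
    (hx : x ∈ U) {D : unipotent n →* unipotent n} (hD : HasFlagPansuDifferentialAt U f D x) :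
    ∃ (A A' : GL (Fin n) ℝ) (V : Set (FlagManifold n)) (h : unipotent n → unipotent n),
      (∀ z ∈ V, A • z ∈ U) ∧ BlowUp (fun z => A'⁻¹ • f (A • z)) V h D := by
  obtain ⟨V₁, hV₁o, hxV₁, hV₁U, g, g', hVg, hVg', -, hlim⟩ := hD
  obtain ⟨V₂, hV₂o, hxV₂, -, hV₂⟩ := hfib x hx
  obtain ⟨a, rfl⟩ := Matrix.ProjGenLinGroup.mk_surjective g
  obtain ⟨a', rfl⟩ := Matrix.ProjGenLinGroup.mk_surjective g'
  set φ := Function.invFun (chart (Matrix.ProjGenLinGroup.mk a : PGL(Fin n, ℝ))) with hφ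
  set φ' := Function.invFun (chart (Matrix.ProjGenLinGroup.mk a' : PGL(Fin n, ℝ))) with hφ'
  set h := φ' ∘ f ∘ chart (Matrix.ProjGenLinGroup.mk a : PGL(Fin n, ℝ)) with hh
  set x₀ := φ x with hx₀
  have hchart : ∀ y : unipotent n, (a * x₀.1) • orbitMap y =
      chart (Matrix.ProjGenLinGroup.mk a : PGL(Fin n, ℝ)) (x₀ * y) := by
    intro y
    change (a * x₀.1) • y.1 • baseFlag n = a • (x₀.1 * y.1) • baseFlag n
    rw [mul_smul, mul_smul]
  have hbase : (a * x₀.1) • baseFlag n = x := by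
    rw [← orbitMap_one, hchart, mul_one]
    exact Function.invFun_eq (hVg hxV₁)
  have hcont := continuous_smul_flag (a * x₀.1)
  refine ⟨a * x₀.1, a' * (h x₀).1, {z | (a * x₀.1) • z ∈ V₁ ∩ V₂}, fun y => (h x₀)⁻¹ * h (x₀ * y),
    fun z hz => hV₁U hz.1, ?_⟩
  refine ⟨(hV₁o.inter hV₂o).preimage hcont, ?_, ?_, ?_, ?_, ?_, ?_⟩
  · change (a * x₀.1) • baseFlag n ∈ V₁ ∩ V₂
    rw [hbase]
    exact ⟨hxV₁, hxV₂⟩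
  · refine (continuous_smul_flag _).comp_continuousOn ?_
    exact hf.comp hcont.continuousOn fun z hz => hV₁U hz.1
  · exact (hV₂.mono inter_subset_right).smul_comp _ _
  · intro y hy
    have h1 : chart (Matrix.ProjGenLinGroup.mk a : PGL(Fin n, ℝ)) (x₀ * y) ∈ V₁ := by
      rw [← hchart]
      exact hy.1
    have h2 : chart (Matrix.ProjGenLinGroup.mk a' : PGL(Fin n, ℝ)) (h (x₀ * y)) =
        f (chart (Matrix.ProjGenLinGroup.mk a : PGL(Fin n, ℝ)) (x₀ * y)) :=
      Function.invFun_eq (hVg' ⟨_, h1, rfl⟩)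
    change (a' * (h x₀).1)⁻¹ • f ((a * x₀.1) • orbitMap y) = _
    rw [hchart, ← h2, inv_smul_eq_iff]
    change a' • (h (x₀ * y)).1 • baseFlag n =
      (a' * (h x₀).1) • ((h x₀).1⁻¹ * (h (x₀ * y)).1) • baseFlag n
    rw [mul_smul, mul_smul, smul_inv_smul]
  · rw [mul_one, inv_mul_cancel]
  · intro y i j
    have h1 := (hlim {y} isCompact_singleton).tendsto_at (mem_singleton y)
    have h2 := tendsto_pi_nhds.1 (tendsto_pi_nhds.1 h1 i) j
    exact h2.comp tendsto_posUnit

end FlagRigidity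

theorem mainTheorem5 (n : ℕ) (hn : 3 ≤ n)
    (U : Set (FlagRigidity.FlagManifold n)) (hUo : IsOpen U) (hUc : IsConnected U)
    (f : FlagRigidity.FlagManifold n → FlagRigidity.FlagManifold n)
    (hf : ContinuousOn f U)
    (hfib : FlagRigidity.LocallyFibrationPreservingOn f U)
    (hD : ∃ x ∈ U, ∃ D : FlagRigidity.unipotent n →* FlagRigidity.unipotent n,
      FlagRigidity.HasFlagPansuDifferentialAt U f D x ∧ Function.Bijective D) :
    ∃ g : PGL(Fin n, ℝ), ∀ x ∈ U, f x = g • x := by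
  obtain ⟨m, rfl⟩ := Nat.exists_eq_add_of_le' hn
  obtain ⟨x, hx, D, hD, hDbij⟩ := hD
  obtain ⟨A, A', V, h, hV, B⟩ := FlagRigidity.exists_blowUp hf hfib hx hD
  obtain ⟨g, z, hz, hgz⟩ := B.exists_projective hDbij.injective
  -- The normalized map `A'⁻¹ ∘ f ∘ A` agrees with `g` near `z`; undoing the normalization gives
  -- this element near `A • z`, and unique continuation extends the agreement to `U`.
  refine ⟨Matrix.ProjGenLinGroup.mk (A' * g * A⁻¹), ?_⟩
  refine FlagRigidity.eqOn_smul_of_eventually hUc.isPreconnected hfib _ (hV z hz) ?_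
  have hA : Tendsto (fun y => A⁻¹ • y) (𝓝 (A • z)) (𝓝 z) := by
    have := (FlagRigidity.continuous_smul_flag A⁻¹).tendsto (A • z)
    rwa [inv_smul_smul] at this
  filter_upwards [hA.eventually hgz] with y hy
  rw [smul_inv_smul, inv_smul_eq_iff] at hy
  rw [hy, mul_smul, mul_smul]
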